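/- Let $\Sigma_2=\{0,1\}^{\mathbf Z}$ with the product topology, and let $\sigma:\Sigma_2\to\Sigma_2$, $(\sigma s)_i=s_{i+1}$, be the shift homeomorphism. A *Denjoy example* is a homeomorphism $g$ of the circle $S^1=\mathbf R/\mathbf Z$ with irrational rotation number such that not every orbit of $g$ is dense in $S^1$; such a $g$ is well known to have a unique minimal set (a nonempty compact invariant set in which every orbit of $g$ is dense). A set $Y\subset\Sigma_2$ with $\sigma(Y)=Y$ is called a *Denjoy minimal set* if $(Y,\sigma|_Y)$ is topologically conjugate to $(K,g|_K)$, where $K$ is the minimal set of some Denjoy example $g$. Let $\mathcal M(\Sigma_2,\sigma)$ be the space of all $\sigma$-invariant Borel probability measures on $\Sigma_2$, with the weak topology ($\mu_n\to\mu$ if and only if $\int f\,d\mu_n\to\int f\,d\mu$ for all continuous $f:\Sigma_2\to\mathbf R$). **Proposition 0.3.** (a) The set of points of $\Sigma_2$ that belong to some Denjoy minimal set is dense in $\Sigma_2$. (b) The set of those $\mu\in\mathcal M(\Sigma_2,\sigma)$ that are the unique $\sigma$-invariant Borel probability measure supported on some Denjoy minimal set $Y\subset\Sigma_2$ (that is,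 $\mu(Y)=1$, and $\mu$ is the only invariant Borel probability measure with this property) is dense in $\mathcal M(\Sigma_2,\sigma)$. -/

import Mathlib

open Set MeasureTheory

namespace DenjoySets

section General

variable {X : Type*} [TopologicalSpace X]

/-- The full (two-sided) orbit `{…, h⁻¹ x, x, h x, …}`. -/
def orbit (h : X ≃ₜ X) (x : X) : Set X := range fun n : ℤ => (h ^ n) x

/-- `(X, h)` is minimal: every orbit is dense. -/
def IsMinimalSystem (h : X ≃ₜ X) : Prop := ∀ x, Dense (orbit h x)

/-- `Y` is invariant under the homeomorphism `h`, i.e. `h` maps `Y` onto `Y`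
(for a bijection this is the pointwise condition below). -/
def IsInvariant (h : X ≃ₜ X) (Y : Set X) : Prop := ∀ x, x ∈ Y ↔ h x ∈ Y

/-- The homeomorphism of an invariant set obtained by restriction. -/
def restrict (h : X ≃ₜ X) {Y : Set X} (hY : IsInvariant h Y) : Y ≃ₜ Y := h.subtype hY

/-- A minimal set of `h`: a nonempty compact invariant set on which `h` is minimal. -/
def IsMinimalSet (h : X ≃ₜ X) (Y : Set X) : Prop :=
  Y.Nonempty ∧ IsCompact Y ∧ ∃ hY : IsInvariant h Y, IsMinimalSystem (restrict h hY)

/-- The circle homeomorphism `g` has a lift `F : ℝ → ℝ` (monotone, commuting with `x ↦ x + 1`)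
whose translation number is irrational; the rotation number of `g` is that number mod `1`. -/
def HasIrrationalRotationNumber (g : UnitAddCircle ≃ₜ UnitAddCircle) : Prop :=
  ∃ F : CircleDeg1Lift, Continuous F ∧ (∀ x : ℝ, ((F x : ℝ) : UnitAddCircle) = g (x : UnitAddCircle)) ∧
    Irrational F.translationNumber

/-- A Denjoy example: a nonminimal circle homeomorphism with irrational rotation number. -/
def IsDenjoyExample (g : UnitAddCircle ≃ₜ UnitAddCircle) : Prop :=
  HasIrrationalRotationNumber g ∧ ¬ IsMinimalSystem g

/-- `(X, h)` is topologically conjugate to the minimal set of a Denjoy example. -/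
def IsDenjoySystem (h : X ≃ₜ X) : Prop :=
  ∃ g : UnitAddCircle ≃ₜ UnitAddCircle, IsDenjoyExample g ∧
    ∃ K : Set UnitAddCircle, IsMinimalSet g K ∧
      ∃ φ : X ≃ₜ K, ∀ x, (φ (h x) : UnitAddCircle) = g (φ x)

/-- `Y` is a Denjoy minimal set of `h`: it is invariant and `h` restricted to `Y` is conjugate to
the minimal set of a Denjoy example. (Then `Y` is automatically nonempty and compact.) -/
def IsDenjoyMinimalSet (h : X ≃ₜ X) (Y : Set X) : Prop :=
  ∃ hY : IsInvariant h Y, IsDenjoySystem (restrict h hY)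

variable [MeasurableSpace X]

/-- The set of `h`-invariant Borel probability measures; it inherits from `ProbabilityMeasure X` the
topology of weak convergence. -/
def invariantMeasures (h : X ≃ₜ X) : Set (ProbabilityMeasure X) :=
  {μ | MeasurePreserving h (μ : Measure X) (μ : Measure X)}

/-- `μ` is the unique `h`-invariant Borel probability measure carried by `Y`. -/
def IsUniqueInvariantMeasureOn (h : X ≃ₜ X) (Y : Set X) (μ : ProbabilityMeasure X) : Prop :=
  (μ ∈ invariantMeasures h ∧ (μ : Measure X) Y = 1) ∧
    ∀ ν ∈ invariantMeasures h, (ν : Measure X) Y = 1 → ν = μ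

end General

/-- The sequence space `{0,1}^ℤ`, with the product topology and the product (Borel) σ-algebra. -/
abbrev TwoShift : Type := ℤ → Fin 2

/-- The shift map `(σ s) i = s (i + 1)`. -/
def shift : TwoShift ≃ₜ TwoShift where
  toFun s i := s (i + 1)
  invFun s i := s (i - 1)
  left_inv s := by funext i; simp
  right_inv s := by funext i; simp
  continuous_toFun := by fun_prop
  continuous_invFun := by fun_prop

end DenjoySets

open Filter Topology Function

namespace DenjoySets

/-! For irrational α, replace every point of the rotation orbit `ℤα + ℤ` by an interval and carry
the intervals affinely onto one another. The result is a Denjoy example whose minimal set consists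
of the ends of the intervals, degenerate ones included. Now take a two-valued step function on the
circle with finitely many jumps, all in that orbit, one of them at 0. Each jump has been opened into
a gap, so the function becomes continuous on the minimal set and so do itineraries. They are
injective (`itinerary_injective`) because such a step function has no translational symmetry. Their
image is therefore a Denjoy minimal set of the shift (`isDenjoyMinimalSet_itinerarySet`). It carries
a single invariant measure because its factor map onto the uniquely ergodic rotation is injective
off a countable set of positions (`isUniqueInvariantMeasureOn_wordMeasure`).

For density, fix a word `w 0, …, w (p - 1)` and let α increase to `1 / p`, with the value `w j` on
the arc `[jα, (j + 1)α)`. The codings of all but finitely many points of the circle converge to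
shifts of the periodic sequence with that word (`exists_denjoy_seq`). So periodic sequences are
limits of points of Denjoy minimal sets, and by dominated convergence periodic orbit measures are
limits of their measures. Periodic sequences are dense, which gives (a).

For (b) it remains to approximate an invariant measure by periodic orbit measures
(`exists_periodicMeasure_approx`). Concatenate blocks of length `L` whose frequencies imitate the
law of a random block. A test function sees essentially a bounded window, so only windows that cross
block boundaries cause errors beyond its small modulus and the frequency error, and their proportion
tends to 0 as `L` grows. -/

/-- The set `ℤα + ℤ`. -/
def rotationOrbit (α : ℝ) : Set ℝ := {x | ∃ n k : ℤ, x = n * α + k}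

theorem intCast_mul_mem_rotationOrbit (α : ℝ) (n : ℤ) : (n * α : ℝ) ∈ rotationOrbit α :=
  ⟨n, 0, by simp⟩

theorem add_mem_rotationOrbit_iff {α β : ℝ} (hβ : β ∈ rotationOrbit α) (x : ℝ) :
    x + β ∈ rotationOrbit α ↔ x ∈ rotationOrbit α := by
  obtain ⟨n, k, rfl⟩ := hβ
  constructor
  · rintro ⟨m, l, h⟩
    exact ⟨m - n, l - k, by push_cast; linarith⟩
  · rintro ⟨m, l, rfl⟩
    exact ⟨m + n, l + k, by push_cast; ring⟩

theorem countable_rotationOrbit (α : ℝ) : (rotationOrbit α).Countable := by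
  have : rotationOrbit α = range fun q : ℤ × ℤ => (q.1 * α + q.2 : ℝ) := by
    ext x; simp [rotationOrbit, eq_comm]
  rw [this]
  exact countable_range _

/-- The line with every point `x` of `ℤα + ℤ` replaced by a nondegenerate interval `[L x, R x]`,
and every other point `x` by a single point `L x = R x`. -/
structure Blowup (α : ℝ) where
  /-- Left end of the interval replacing a point. -/
  L : ℝ → ℝ
  /-- Right end of the interval replacing a point. -/
  R : ℝ → ℝ
  le : ∀ x, L x ≤ R x
  lt : ∀ {x y}, x < y → R x < L y
  cover : ∀ y, ∃ x, L x ≤ y ∧ y ≤ R x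
  L_add_one : ∀ x, L (x + 1) = L x + 1
  R_add_one : ∀ x, R (x + 1) = R x + 1
  lt_iff : ∀ x, L x < R x ↔ x ∈ rotationOrbit α

/-! ### Existence of the blow-up, from a jump function. -/

section Existence

variable {H : ℝ → ℝ}

theorem tendsto_nhdsLT_of_strictMono {f : ℝ → ℝ} (hf : StrictMono f) (hc : Continuous f) (x : ℝ) :
    Tendsto f (𝓝[<] x) (𝓝[<] f x) := by
  refine tendsto_nhdsWithin_iff.2 ⟨hc.continuousAt.mono_left nhdsWithin_le_nhds, ?_⟩
  filter_upwards [self_mem_nhdsWithin] with t ht using hf ht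

theorem tendsto_nhdsGT_of_strictMono {f : ℝ → ℝ} (hf : StrictMono f) (hc : Continuous f) (x : ℝ) :
    Tendsto f (𝓝[>] x) (𝓝[>] f x) := by
  refine tendsto_nhdsWithin_iff.2 ⟨hc.continuousAt.mono_left nhdsWithin_le_nhds, ?_⟩
  filter_upwards [self_mem_nhdsWithin] with t ht using hf ht

theorem strictMono_add_const (c : ℝ) : StrictMono fun t : ℝ => t + c := fun _ _ h => by
  simpa using h

theorem leftLim_add_one (hH : Monotone H) (h1 : ∀ x, H (x + 1) = H x + 1) (x : ℝ) :
    leftLim H (x + 1) = leftLim H x + 1 := by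
  have a := (hH.tendsto_leftLim (x + 1)).comp 
    (tendsto_nhdsLT_of_strictMono (strictMono_add_const 1) (by fun_prop) x)
  have b := (hH.tendsto_leftLim x).add_const 1
  exact tendsto_nhds_unique (a.congr fun t => h1 t) b

theorem rightLim_add_one (hH : Monotone H) (h1 : ∀ x, H (x + 1) = H x + 1) (x : ℝ) :
    rightLim H (x + 1) = rightLim H x + 1 := by
  have a := (hH.tendsto_rightLim (x + 1)).comp 
    (tendsto_nhdsGT_of_strictMono (strictMono_add_const 1) (by fun_prop) x)
  have b := (hH.tendsto_rightLim x).add_const 1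
  exact tendsto_nhds_unique (a.congr fun t => h1 t) b

theorem apply_add_int (h1 : ∀ x, H (x + 1) = H x + 1) (x : ℝ) (n : ℤ) : H (x + n) = H x + n := by
  induction n using Int.induction_on with
  | zero => simp
  | succ n ih => rw [Int.cast_add, Int.cast_one, ← add_assoc, h1, ih]; ring
  | pred n ih =>
    have := h1 (x + ((-n - 1 : ℤ) : ℝ))
    rw [show x + ((-n - 1 : ℤ) : ℝ) + 1 = x + ((-n : ℤ) : ℝ) by push_cast; ring, ih] at this
    push_cast at this ⊢
    linarith

/-- The supremum of `{x | H x ≤ y}` works; degree one makes this set nonempty and bounded above. -/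
theorem exists_leftLim_le_le_rightLim (hH : Monotone H) (h1 : ∀ x, H (x + 1) = H x + 1) (y : ℝ) :
    ∃ x, leftLim H x ≤ y ∧ y ≤ rightLim H x := by
  have key : ∀ n : ℤ, H n = H 0 + n := fun n => by simpa using apply_add_int h1 0 n
  set S := {x | H x ≤ y}
  have hne : S.Nonempty := ⟨(⌊y - H 0⌋ : ℤ), by
    have := Int.floor_le (y - H 0)
    simp only [S, mem_ofPred_eq, key]; linarith⟩
  have hbdd : BddAbove S := ⟨(⌊y - H 0⌋ + 1 : ℤ), fun x hx => by
    by_contra hc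
    have h2 := hH (not_le.1 hc).le
    rw [key] at h2
    have := Int.lt_floor_add_one (y - H 0)
    simp only [S, mem_ofPred_eq] at hx
    push_cast at h2
    linarith⟩
  refine ⟨sSup S, ?_, ?_⟩
  · refine le_of_tendsto (hH.tendsto_leftLim _) ?_
    filter_upwards [self_mem_nhdsWithin] with t ht
    obtain ⟨s, hs, hts⟩ := exists_lt_of_lt_csSup hne ht
    exact (hH hts.le).trans hs
  · refine ge_of_tendsto (hH.tendsto_rightLim _) ?_
    filter_upwards [self_mem_nhdsWithin] with t ht
    by_contra hc
    exact absurd (le_csSup hbdd (not_le.1 hc).le) (not_le.2 ht)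

/-- A strictly increasing degree-one function whose discontinuities form `ℤα + ℤ` gives a
blow-up. -/
noncomputable def Blowup.ofStrictMono {α : ℝ} (hH : StrictMono H) (h1 : ∀ x, H (x + 1) = H x + 1)
    (hd : ∀ x, ContinuousAt H x ↔ x ∉ rotationOrbit α) : Blowup α where
  L := leftLim H
  R := rightLim H
  le x := hH.monotone.leftLim_le_rightLim le_rfl
  lt {x y} hxy := by
    obtain ⟨u, hxu, huy⟩ := exists_between hxy
    obtain ⟨v, huv, hvy⟩ := exists_between huy
    exact (hH.monotone.rightLim_le hxu).trans_lt ((hH huv).trans_le (hH.monotone.le_leftLim hvy))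
  cover := exists_leftLim_le_le_rightLim hH.monotone h1
  L_add_one := leftLim_add_one hH.monotone h1
  R_add_one := rightLim_add_one hH.monotone h1
  lt_iff x := by
    have := hd x
    rw [hH.monotone.continuousAt_iff_leftLim_eq_rightLim] at this
    have hle := hH.monotone.leftLim_le_rightLim (le_refl x)
    constructor
    · intro h; by_contra hc; exact h.ne (this.2 hc)
    · intro h; exact lt_of_le_of_ne hle fun e => this.1 e h

/-- Subtract from the identity sawtooth functions with teeth at `nα + ℤ` and positive weights `a n`
of total less than 1. Each tooth gives an upward jump, and the remaining slope `1 - c` keeps the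
function strictly increasing. -/
theorem exists_blowup (α : ℝ) : Nonempty (Blowup α) := by
  obtain ⟨a', ha', c, hc, hc1⟩ := NNReal.exists_pos_sum_of_countable (ε := 1) one_ne_zero ℤ
  set a : ℤ → ℝ := fun n => a' n
  have ha : ∀ n, 0 < a n := fun n => NNReal.coe_pos.2 (ha' n)
  have hsum : HasSum a c := NNReal.hasSum_coe.2 hc
  have hc1 : (c : ℝ) < 1 := by exact_mod_cast hc1
  have hfr : ∀ x, Summable fun n : ℤ => a n * Int.fract (x - n * α) := fun x => by
    refine Summable.of_nonneg_of_le (fun n => mul_nonneg (ha n).le (Int.fract_nonneg _))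
      (fun n => ?_) hsum.summable
    exact mul_le_of_le_one_right (ha n).le (Int.fract_lt_one _).le
  set H : ℝ → ℝ := fun x => x - ∑' n : ℤ, a n * Int.fract (x - n * α) with hHdef
  -- Writing the fractional part as identity minus floor splits the increment into a linear part and
  -- the accumulated jumps.
  have hdiff : ∀ x y, H y - H x = (1 - c) * (y - x) +
      ∑' n : ℤ, a n * ((⌊y - n * α⌋ : ℝ) - ⌊x - n * α⌋) := fun x y => by
    have e : ∀ n : ℤ, a n * ((⌊y - n * α⌋ : ℝ) - ⌊x - n * α⌋) =
        a n * (y - x) - (a n * Int.fract (y - n * α) - a n * Int.fract (x - n * α)) := fun n => by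
      simp only [Int.fract]; ring
    simp_rw [e]
    rw [((hsum.mul_right (y - x)).summable).tsum_sub ((hfr y).sub (hfr x)), (hfr y).tsum_sub (hfr x),
      (hsum.mul_right (y - x)).tsum_eq]
    simp only [hHdef]; ring
  have hsd : ∀ x y, Summable fun n : ℤ => a n * ((⌊y - n * α⌋ : ℝ) - ⌊x - n * α⌋) := fun x y => by
    refine (((hsum.mul_right (y - x)).summable).sub ((hfr y).sub (hfr x))).congr fun n => ?_
    simp only [Int.fract]; ring
  have hnn : ∀ {x y : ℝ}, x ≤ y → ∀ n : ℤ, 0 ≤ a n * ((⌊y - n * α⌋ : ℝ) - ⌊x - n * α⌋) :=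
    fun {x y} hxy n => mul_nonneg (ha n).le (sub_nonneg.2 (by
      exact_mod_cast Int.floor_le_floor (by linarith)))
  have hmono : StrictMono H := fun x y hxy => by
    have h0 := tsum_nonneg (L := .unconditional ℤ) (hnn hxy.le)
    have h1 : 0 < (1 - (c : ℝ)) * (y - x) := mul_pos (by linarith) (by linarith)
    have := hdiff x y
    linarith
  have h1 : ∀ x, H (x + 1) = H x + 1 := fun x => by
    have : ∀ n : ℤ, Int.fract (x + 1 - n * α) = Int.fract (x - n * α) := fun n => by
      rw [show x + 1 - n * α = x - n * α + 1 by ring, Int.fract_add_one]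
    simp only [hHdef, this]; ring
  refine ⟨Blowup.ofStrictMono hmono h1 fun x => ⟨?_, ?_⟩⟩
  · rintro hcont ⟨n, k, rfl⟩
    set x : ℝ := n * α + k
    -- The `n`-th floor alone gains at least 1 on reaching `nα + k`, which forces a jump of at least
    -- `a n`.
    have hj : ∀ t < x, H t ≤ H x - a n := fun t ht => by
      have hle : a n ≤ a n * ((⌊x - n * α⌋ : ℝ) - ⌊t - n * α⌋) := by
        refine le_mul_of_one_le_right (ha n).le ?_
        have e1 : ⌊x - n * α⌋ = k := by simp [x]
        have e2 : ⌊t - n * α⌋ < k := Int.floor_lt.2 (by simp only [x] at ht; linarith)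
        rw [e1]
        have : (⌊t - n * α⌋ : ℝ) + 1 ≤ k := by exact_mod_cast e2
        linarith
      have h2 := (hsd t x).le_tsum n fun m _ => hnn ht.le m
      have h3 : 0 ≤ (1 - (c : ℝ)) * (x - t) := mul_nonneg (by linarith) (by linarith)
      have := hdiff t x
      linarith
    have hlim : Tendsto H (𝓝[<] x) (𝓝 (H x)) := hcont.tendsto.mono_left nhdsWithin_le_nhds
    have := le_of_tendsto hlim (by filter_upwards [self_mem_nhdsWithin] with t ht using hj t ht)
    linarith [ha n]
  · intro hx
    refine continuousAt_id.sub ?_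
    refine tendsto_tsum_of_dominated_convergence hsum.summable (fun n => ?_) (.of_forall fun t n => ?_)
    · refine Tendsto.const_mul _ ?_
      have hne : x - n * α ≠ ⌊x - n * α⌋ := fun e => hx ⟨n, ⌊x - n * α⌋, by linarith⟩
      have := continuousAt_fract hne
      exact ContinuousAt.comp (g := Int.fract) (f := fun t : ℝ => t - n * α) this (by fun_prop)
    · rw [Real.norm_of_nonneg (mul_nonneg (ha n).le (Int.fract_nonneg _))]
      exact mul_le_of_le_one_right (ha n).le (Int.fract_lt_one _).le

end Existence

/-! ### Circle maps and their lifts. -/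

section Circle

/-- The circle map with a given lift. -/
def onCircle (F : CircleDeg1Lift) : UnitAddCircle → UnitAddCircle :=
  Function.Periodic.lift (f := fun x : ℝ => (F x : UnitAddCircle)) (c := 1) fun x => by
    simp only [F.map_add_one]; exact AddCircle.coe_add_period 1 _

@[simp] theorem onCircle_coe (F : CircleDeg1Lift) (x : ℝ) :
    onCircle F (x : UnitAddCircle) = (F x : UnitAddCircle) := rfl

theorem isQuotientMap_coe_unitAddCircle : IsQuotientMap ((↑) : ℝ → UnitAddCircle) :=
  isQuotientMap_quotient_mk'

theorem isOpenMap_coe_unitAddCircle : IsOpenMap ((↑) : ℝ → UnitAddCircle) :=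
  QuotientAddGroup.isOpenMap_coe

theorem continuous_onCircle {F : CircleDeg1Lift} (hF : Continuous F) : Continuous (onCircle F) :=
  isQuotientMap_coe_unitAddCircle.continuous_iff.2
    ((AddCircle.continuous_mk' 1).comp hF)

theorem nhds_coe_unitAddCircle (x : ℝ) : 𝓝 (x : UnitAddCircle) = map (↑) (𝓝 x) :=
  (isOpenMap_coe_unitAddCircle.map_nhds_eq (AddCircle.continuous_mk' 1).continuousAt).symm

theorem coe_unitAddCircle_eq_iff {x y : ℝ} :
    (x : UnitAddCircle) = y ↔ ∃ k : ℤ, y = x + k := by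
  rw [eq_comm, ← sub_eq_zero, ← AddCircle.coe_sub, AddCircle.coe_eq_zero_iff]
  simp only [zsmul_eq_mul, mul_one]
  exact exists_congr fun k => ⟨fun h => by linarith, fun h => by linarith⟩

@[simp] theorem coe_unitAddCircle_add_int (x : ℝ) (k : ℤ) : ((x + k : ℝ) : UnitAddCircle) = x :=
  (coe_unitAddCircle_eq_iff.2 ⟨k, rfl⟩).symm

end Circle

section Irrational

variable {α : ℝ}

theorem exists_add_mul_add_mem_Ioo (hα : Irrational α) (x : ℝ) {a b : ℝ} (hab : a < b) :
    ∃ n k : ℤ, x + n * α + k ∈ Ioo a b := by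
  have hd : Dense (AddSubgroup.closure {α, 1} : Set ℝ) :=
    dense_addSubgroupClosure_pair_iff.2 (by simpa using hα)
  obtain ⟨z, hz, hz1, hz2⟩ := hd.exists_between (show a - x < b - x by linarith)
  obtain ⟨n, k, rfl⟩ := AddSubgroup.mem_closure_pair.1 hz
  simp only [zsmul_eq_mul, mul_one] at hz1 hz2
  exact ⟨n, k, by linarith, by linarith⟩

theorem exists_of_eventually_nhdsGT (hα : Irrational α) (x : ℝ) {t : ℝ} {P : ℝ → Prop}
    (h : ∀ᶠ u in 𝓝[>] t, P u) : ∃ n k : ℤ, P (x + n * α + k) := by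
  obtain ⟨b, hb, hP⟩ := mem_nhdsGT_iff_exists_Ioo_subset.1 h
  obtain ⟨n, k, hn⟩ := exists_add_mul_add_mem_Ioo hα x hb
  exact ⟨n, k, hP hn⟩

theorem exists_of_eventually_nhdsLT (hα : Irrational α) (x : ℝ) {t : ℝ} {P : ℝ → Prop}
    (h : ∀ᶠ u in 𝓝[<] t, P u) : ∃ n k : ℤ, P (x + n * α + k) := by
  obtain ⟨b, hb, hP⟩ := mem_nhdsLT_iff_exists_Ioo_subset.1 h
  obtain ⟨n, k, hn⟩ := exists_add_mul_add_mem_Ioo hα x hb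
  exact ⟨n, k, hP hn⟩

end Irrational

theorem coe_restrict_zpow {X : Type*} [TopologicalSpace X] (h : X ≃ₜ X) {Y : Set X}
    (hY : IsInvariant h Y) (n : ℤ) (x : Y) : (((restrict h hY) ^ n) x : X) = (h ^ n) x := by
  have h1 : ∀ x : Y, ((restrict h hY) x : X) = h x := fun _ => rfl
  have h2 : ∀ x : Y, ((restrict h hY)⁻¹ x : X) = h⁻¹ x := fun _ => rfl
  induction n using Int.induction_on generalizing x with
  | zero => rfl
  | succ n ih => rw [zpow_add_one, zpow_add_one]; exact ih _
  | pred n ih => rw [zpow_sub_one, zpow_sub_one]; exact ih _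

/-! ### The Denjoy homeomorphism and its minimal set. -/

namespace Blowup

variable {α : ℝ} (B : Blowup α)

/-- The point blown up to the interval containing `y`. -/
noncomputable def collapse (y : ℝ) : ℝ := (B.cover y).choose

theorem L_collapse_le (y : ℝ) : B.L (B.collapse y) ≤ y := (B.cover y).choose_spec.1

theorem le_R_collapse (y : ℝ) : y ≤ B.R (B.collapse y) := (B.cover y).choose_spec.2

theorem collapse_mono : Monotone B.collapse := fun y z hyz => by
  by_contra! h
  linarith [B.lt h, B.L_collapse_le y, B.le_R_collapse z]

theorem collapse_eq {x y : ℝ} (h1 : B.L x ≤ y) (h2 : y ≤ B.R x) : B.collapse y = x := by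
  rcases lt_trichotomy (B.collapse y) x with h | h | h
  · linarith [B.lt h, B.le_R_collapse y]
  · exact h
  · linarith [B.lt h, B.L_collapse_le y]

@[simp] theorem collapse_L (x : ℝ) : B.collapse (B.L x) = x := B.collapse_eq le_rfl (B.le x)

@[simp] theorem collapse_R (x : ℝ) : B.collapse (B.R x) = x := B.collapse_eq (B.le x) le_rfl

theorem continuous_collapse : Continuous B.collapse :=
  B.collapse_mono.continuous_of_surjective fun x => ⟨_, B.collapse_L x⟩

theorem collapse_add_one (y : ℝ) : B.collapse (y + 1) = B.collapse y + 1 :=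
  B.collapse_eq (by rw [B.L_add_one]; linarith [B.L_collapse_le y])
    (by rw [B.R_add_one]; linarith [B.le_R_collapse y])

theorem collapse_add_int (y : ℝ) (k : ℤ) : B.collapse (y + k) = B.collapse y + k :=
  apply_add_int B.collapse_add_one y k

theorem L_add_int (x : ℝ) (k : ℤ) : B.L (x + k) = B.L x + k := apply_add_int B.L_add_one x k

theorem R_add_int (x : ℝ) (k : ℤ) : B.R (x + k) = B.R x + k := apply_add_int B.R_add_one x k

/-- The length of the interval replacing a point. -/
def len (x : ℝ) : ℝ := B.R x - B.L x

theorem len_nonneg (x : ℝ) : 0 ≤ B.len x := sub_nonneg.2 (B.le x)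

theorem len_pos_iff (x : ℝ) : 0 < B.len x ↔ x ∈ rotationOrbit α := by
  rw [len, sub_pos, B.lt_iff]

theorem len_eq_zero_iff (x : ℝ) : B.len x = 0 ↔ x ∉ rotationOrbit α := by
  rw [← B.len_pos_iff, (B.len_nonneg x).lt_iff_ne', not_not]

/-- The map that sends each blown-up point `[L x, R x]` affinely onto `[L (x + β), R (x + β)]`. -/
noncomputable def flow (β y : ℝ) : ℝ :=
  B.L (B.collapse y + β) +
    (y - B.L (B.collapse y)) * (B.len (B.collapse y + β) / B.len (B.collapse y))

variable {B} {β γ : ℝ}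

theorem L_le_flow (β y : ℝ) : B.L (B.collapse y + β) ≤ B.flow β y :=
  le_add_of_nonneg_right (mul_nonneg (sub_nonneg.2 (B.L_collapse_le y))
    (div_nonneg (B.len_nonneg _) (B.len_nonneg _)))

theorem flow_le_R (β y : ℝ) : B.flow β y ≤ B.R (B.collapse y + β) := by
  have h1 := B.le_R_collapse y
  have h2 := B.len_nonneg (B.collapse y)
  have h3 := B.len_nonneg (B.collapse y + β)
  have h4 : (y - B.L (B.collapse y)) * (B.len (B.collapse y + β) / B.len (B.collapse y)) ≤
      B.len (B.collapse y + β) := by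
    rcases h2.eq_or_lt with h | h
    · rw [← h]; simpa using h3
    · rw [← mul_div_assoc, div_le_iff₀ h, mul_comm]
      exact mul_le_mul_of_nonneg_left (by rw [len]; linarith) h3
  rw [flow]
  have : B.R (B.collapse y + β) = B.L (B.collapse y + β) + B.len (B.collapse y + β) := by
    rw [len]; ring
  linarith

@[simp] theorem collapse_flow (β y : ℝ) : B.collapse (B.flow β y) = B.collapse y + β :=
  B.collapse_eq (L_le_flow β y) (flow_le_R β y)

theorem eq_L_of_len_eq_zero {y : ℝ} (h : B.len (B.collapse y) = 0) : y = B.L (B.collapse y) := by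
  rw [len] at h
  linarith [B.L_collapse_le y, B.le_R_collapse y]

theorem flow_flow (hγ : γ ∈ rotationOrbit α) (y : ℝ) :
    B.flow β (B.flow γ y) = B.flow (γ + β) y := by
  conv_lhs => rw [flow, collapse_flow]
  conv_rhs => rw [flow]
  rw [add_assoc]
  congr 1
  rw [flow, add_sub_cancel_left]
  -- Over a degenerate interval the division by zero returns 0, which is harmless. Otherwise the
  -- intermediate length must cancel, and it is nonzero because translation by `γ` preserves the
  -- orbit.
  by_cases h : B.len (B.collapse y) = 0
  · simp [h]
  · have h' : B.len (B.collapse y + γ) ≠ 0 := by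
      rwa [Ne, len_eq_zero_iff, add_mem_rotationOrbit_iff hγ, ← len_eq_zero_iff]
    field_simp

@[simp] theorem flow_zero (y : ℝ) : B.flow 0 y = y := by
  rw [flow, add_zero]
  by_cases h : B.len (B.collapse y) = 0
  · rw [← eq_L_of_len_eq_zero h]; simp
  · rw [div_self h]; ring

theorem flow_L (β x : ℝ) : B.flow β (B.L x) = B.L (x + β) := by
  rw [flow, collapse_L]; simp

theorem flow_R (hβ : β ∈ rotationOrbit α) (x : ℝ) : B.flow β (B.R x) = B.R (x + β) := by
  rw [flow, collapse_R]
  by_cases h : B.len x = 0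
  · have h' : B.len (x + β) = 0 := by
      rwa [len_eq_zero_iff, add_mem_rotationOrbit_iff hβ, ← len_eq_zero_iff]
    rw [h, div_zero, mul_zero, add_zero]
    rw [len] at h'; linarith
  · rw [show B.R x - B.L x = B.len x from rfl, mul_div_cancel₀ _ h, len]; ring

theorem flow_add_one (β y : ℝ) : B.flow β (y + 1) = B.flow β y + 1 := by
  have hlen : ∀ x, B.len (x + 1) = B.len x := fun x => by
    rw [len, len, B.L_add_one, B.R_add_one]; ring
  rw [flow, flow, collapse_add_one, add_right_comm, B.L_add_one, B.L_add_one, hlen, hlen]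
  ring

theorem flow_mono (β : ℝ) : Monotone (B.flow β) := fun y z hyz => by
  rcases (B.collapse_mono hyz).eq_or_lt with h | h
  · rw [flow, flow, h]
    have := div_nonneg (B.len_nonneg (B.collapse z + β)) (B.len_nonneg (B.collapse z))
    gcongr
  · have := B.lt (show B.collapse y + β < B.collapse z + β by linarith)
    linarith [flow_le_R (B := B) β y, L_le_flow (B := B) β z]

theorem neg_mem_rotationOrbit (hβ : β ∈ rotationOrbit α) : -β ∈ rotationOrbit α := by
  obtain ⟨n, k, rfl⟩ := hβ
  exact ⟨-n, -k, by push_cast; ring⟩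

/-- A monotone surjection of the line is continuous, and the flow by `-β` supplies preimages. -/
theorem continuous_flow (hβ : β ∈ rotationOrbit α) : Continuous (B.flow β) :=
  (flow_mono β).continuous_of_surjective fun y =>
    ⟨B.flow (-β) y, by rw [flow_flow (neg_mem_rotationOrbit hβ)]; simp⟩

variable (B)

/-- `flow` as a degree-one map. -/
noncomputable def flowLift (β : ℝ) : CircleDeg1Lift where
  toFun := B.flow β
  monotone' := flow_mono β
  map_add_one' := flow_add_one β

/-- `collapse` as a degree-one map. -/
noncomputable def collapseLift : CircleDeg1Lift where
  toFun := B.collapse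
  monotone' := B.collapse_mono
  map_add_one' := B.collapse_add_one

theorem self_mem_rotationOrbit (α : ℝ) : α ∈ rotationOrbit α := ⟨1, 0, by simp⟩

/-- The circle homeomorphism obtained from the rotation by `α` by blowing up the orbit of `0`. -/
noncomputable def homeo : UnitAddCircle ≃ₜ UnitAddCircle where
  toFun := onCircle (B.flowLift α)
  invFun := onCircle (B.flowLift (-α))
  left_inv z := by
    induction z using QuotientAddGroup.induction_on with | H y => ?_
    change ((B.flow (-α) (B.flow α y) : ℝ) : UnitAddCircle) = y
    rw [flow_flow (self_mem_rotationOrbit α)]; simp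
  right_inv z := by
    induction z using QuotientAddGroup.induction_on with | H y => ?_
    change ((B.flow α (B.flow (-α) y) : ℝ) : UnitAddCircle) = y
    rw [flow_flow (neg_mem_rotationOrbit (self_mem_rotationOrbit α))]; simp
  continuous_toFun := continuous_onCircle (continuous_flow (self_mem_rotationOrbit α))
  continuous_invFun :=
    continuous_onCircle (continuous_flow (neg_mem_rotationOrbit (self_mem_rotationOrbit α)))

theorem homeo_coe (y : ℝ) : B.homeo (y : UnitAddCircle) = (B.flow α y : ℝ) := rfl

theorem homeo_zpow_coe (n : ℤ) (y : ℝ) :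
    (B.homeo ^ n) (y : UnitAddCircle) = (B.flow (n * α) y : ℝ) := by
  induction n using Int.induction_on generalizing y with
  | zero => simp
  | succ n ih =>
    rw [zpow_add_one, Homeomorph.mul_apply, homeo_coe, ih, flow_flow (self_mem_rotationOrbit α)]
    congr 2; push_cast; ring
  | pred n ih =>
    have : B.homeo⁻¹ (y : UnitAddCircle) = (B.flow (-α) y : ℝ) := rfl
    rw [zpow_sub_one, Homeomorph.mul_apply, this, ih,
      flow_flow (neg_mem_rotationOrbit (self_mem_rotationOrbit α))]
    congr 2; push_cast; ring

/-- Collapsing the intervals semiconjugates the lift to translation by α, and semiconjugacy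
preserves the translation number. -/
theorem hasIrrationalRotationNumber_homeo (hα : Irrational α) :
    HasIrrationalRotationNumber B.homeo := by
  refine ⟨B.flowLift α, continuous_flow (self_mem_rotationOrbit α), fun x => rfl, ?_⟩
  have hs : Semiconj B.collapseLift (B.flowLift α)
      (CircleDeg1Lift.translate (Multiplicative.ofAdd α)) := fun y => by
    change B.collapse (B.flow α y) = α + B.collapse y
    rw [collapse_flow, add_comm]
  rw [CircleDeg1Lift.translationNumber_eq_of_semiconj hs, CircleDeg1Lift.translationNumber_translate]
  exact hα

/-- The endpoints of the blown-up intervals; this is the minimal set of `homeo`. -/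
def core : Set UnitAddCircle := {z | ∃ x : ℝ, z = (B.L x : ℝ) ∨ z = (B.R x : ℝ)}

variable {B}

theorem coe_mem_core_iff {y : ℝ} :
    (y : UnitAddCircle) ∈ B.core ↔ y = B.L (B.collapse y) ∨ y = B.R (B.collapse y) := by
  constructor
  · rintro ⟨x, h | h⟩
    · obtain ⟨k, hk⟩ := coe_unitAddCircle_eq_iff.1 h.symm
      left; rw [hk, ← B.L_add_int, collapse_L]
    · obtain ⟨k, hk⟩ := coe_unitAddCircle_eq_iff.1 h.symm
      right; rw [hk, ← B.R_add_int, collapse_R]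
  · rintro (h | h)
    · exact ⟨_, Or.inl (congrArg _ h)⟩
    · exact ⟨_, Or.inr (congrArg _ h)⟩

theorem isClosed_core : IsClosed B.core := by
  rw [← isQuotientMap_coe_unitAddCircle.isClosed_preimage]
  have : ((↑) : ℝ → UnitAddCircle) ⁻¹' B.core = (⋃ x, Ioo (B.L x) (B.R x))ᶜ := by
    ext y
    rw [mem_preimage, coe_mem_core_iff, mem_compl_iff, mem_iUnion, not_exists]
    constructor
    · rintro h x ⟨hx1, hx2⟩
      rw [B.collapse_eq hx1.le hx2.le] at h
      rcases h with h | h <;> linarith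
    · intro h
      by_contra! hc
      exact h _ ⟨lt_of_le_of_ne (B.L_collapse_le y) hc.1.symm,
        lt_of_le_of_ne (B.le_R_collapse y) hc.2⟩
  rw [this]
  exact (isOpen_iUnion fun x => isOpen_Ioo).isClosed_compl

theorem core_ne_univ : B.core ≠ univ := by
  intro h
  have hlt := (B.lt_iff 0).2 ⟨0, 0, by simp⟩
  have hm : (((B.L 0 + B.R 0) / 2 : ℝ) : UnitAddCircle) ∈ B.core := h ▸ mem_univ _
  rw [coe_mem_core_iff, B.collapse_eq (x := 0) (by linarith) (by linarith)] at hm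
  rcases hm with h | h <;> linarith

theorem isInvariant_core : IsInvariant B.homeo B.core := by
  intro z
  induction z using QuotientAddGroup.induction_on with | H y => ?_
  change (y : UnitAddCircle) ∈ B.core ↔ B.homeo (y : UnitAddCircle) ∈ B.core
  have hα := self_mem_rotationOrbit α
  constructor
  · intro h
    rw [homeo_coe, coe_mem_core_iff, collapse_flow, ← flow_L, ← flow_R hα]
    exact (coe_mem_core_iff.1 h).imp (congrArg _) (congrArg _)
  · intro h
    rw [homeo_coe, coe_mem_core_iff, collapse_flow] at h
    have e : y = B.flow (-α) (B.flow α y) := by rw [flow_flow hα]; simp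
    rw [coe_mem_core_iff]
    refine h.imp (fun h => ?_) fun h => ?_
    · rw [h, flow_L] at e; simpa using e
    · rw [h, flow_R (neg_mem_rotationOrbit hα)] at e; simpa using e

/-- A point `b` to the right of `R x` lies over a point beyond `x`, so the whole interval over any
`u` strictly between these base points is squeezed between `R x` and `b`. -/
theorem eventually_Icc_subset_of_mem_nhds_R {x : ℝ} {V : Set ℝ} (hV : V ∈ 𝓝 (B.R x)) :
    ∀ᶠ u in 𝓝[>] x, Icc (B.L u) (B.R u) ⊆ V := by
  obtain ⟨b, hb, hsub⟩ := (mem_nhdsGE_iff_exists_Icc_subset).1 (mem_nhdsWithin_of_mem_nhds hV)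
  have hc : x < B.collapse b := by
    by_contra! hc
    rcases hc.eq_or_lt with h | h
    · have := B.le_R_collapse b; rw [h] at this; exact absurd hb (not_lt.2 this)
    · have h1 := B.lt h
      have h2 : B.R x < b := hb
      linarith [B.le_R_collapse b, B.le x]
  filter_upwards [Ioo_mem_nhdsGT hc] with u hu
  refine (Icc_subset_Icc (B.lt hu.1).le ?_).trans hsub
  exact (B.lt hu.2).le.trans (B.L_collapse_le b)

theorem eventually_Icc_subset_of_mem_nhds_L {x : ℝ} {V : Set ℝ} (hV : V ∈ 𝓝 (B.L x)) :
    ∀ᶠ u in 𝓝[<] x, Icc (B.L u) (B.R u) ⊆ V := by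
  obtain ⟨b, hb, hsub⟩ := (mem_nhdsLE_iff_exists_Icc_subset).1 (mem_nhdsWithin_of_mem_nhds hV)
  have hc : B.collapse b < x := by
    by_contra! hc
    rcases hc.eq_or_lt with h | h
    · have := B.L_collapse_le b; rw [← h] at this; exact absurd hb (not_lt.2 this)
    · have h1 := B.lt h
      have h2 : b < B.L x := hb
      linarith [B.L_collapse_le b, B.le x]
  filter_upwards [Ioo_mem_nhdsLT hc] with u hu
  refine (Icc_subset_Icc ?_ (B.lt hu.2).le).trans hsub
  exact (B.le_R_collapse b).trans (B.lt hu.1).le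

/-- Whole intervals accumulate at a left end from the left and at a right end from the right. Some
interval of the orbit of `y` is among them, since the rotation orbit is dense, and it contains an
orbit point wherever `y` sits in its own interval. -/
theorem mem_closure_range_homeo_zpow (hα : Irrational α) (y : ℝ) {z : UnitAddCircle}
    (hz : z ∈ B.core) : z ∈ closure (range fun n : ℤ => (B.homeo ^ n) (y : UnitAddCircle)) := by
  rw [mem_closure_iff_nhds]
  intro U hU
  have key : ∀ n k : ℤ, Icc (B.L (B.collapse y + n * α + k)) (B.R (B.collapse y + n * α + k)) ⊆
      ((↑) : ℝ → UnitAddCircle) ⁻¹' U →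
      (U ∩ range fun n : ℤ => (B.homeo ^ n) (y : UnitAddCircle)).Nonempty := by
    intro n k h
    have hm : B.flow (n * α) y + k ∈ Icc (B.L (B.collapse y + n * α + k))
        (B.R (B.collapse y + n * α + k)) := by
      rw [← collapse_flow, ← B.collapse_add_int]
      exact ⟨B.L_collapse_le _, B.le_R_collapse _⟩
    refine ⟨(B.homeo ^ n) (y : UnitAddCircle), ?_, n, rfl⟩
    have := h hm
    rwa [mem_preimage, coe_unitAddCircle_add_int, ← homeo_zpow_coe] at this
  obtain ⟨x, rfl | rfl⟩ := hz
  · have hV : ((↑) : ℝ → UnitAddCircle) ⁻¹' U ∈ 𝓝 (B.L x) :=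
      (AddCircle.continuous_mk' 1).continuousAt hU
    obtain ⟨n, k, h⟩ := exists_of_eventually_nhdsLT hα (B.collapse y)
      (eventually_Icc_subset_of_mem_nhds_L hV)
    exact key n k h
  · have hV : ((↑) : ℝ → UnitAddCircle) ⁻¹' U ∈ 𝓝 (B.R x) :=
      (AddCircle.continuous_mk' 1).continuousAt hU
    obtain ⟨n, k, h⟩ := exists_of_eventually_nhdsGT hα (B.collapse y)
      (eventually_Icc_subset_of_mem_nhds_R hV)
    exact key n k h

theorem isMinimalSet_core (hα : Irrational α) : IsMinimalSet B.homeo B.core := by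
  refine ⟨⟨_, 0, Or.inl rfl⟩, isClosed_core.isCompact, isInvariant_core, ?_⟩
  rintro ⟨y, hy⟩ z
  rw [closure_subtype]
  induction y using QuotientAddGroup.induction_on with | H y => ?_
  have := mem_closure_range_homeo_zpow hα y z.2
  rwa [orbit, ← range_comp, show (((↑) : B.core → UnitAddCircle) ∘ fun n : ℤ =>
    (restrict B.homeo isInvariant_core ^ n) ⟨_, hy⟩) =
    fun n : ℤ => (B.homeo ^ n) (y : UnitAddCircle) from
    funext fun n => coe_restrict_zpow _ _ _ _]

theorem homeo_zpow_mem_core {z : UnitAddCircle} (hz : z ∈ B.core) (n : ℤ) :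
    (B.homeo ^ n) z ∈ B.core := by
  rw [← coe_restrict_zpow B.homeo isInvariant_core n ⟨z, hz⟩]
  exact Subtype.coe_prop _

/-- An orbit starting in the core stays in a proper closed set, so it is not dense. -/
theorem isDenjoyExample_homeo (hα : Irrational α) : IsDenjoyExample B.homeo := by
  refine ⟨B.hasIrrationalRotationNumber_homeo hα, fun h => core_ne_univ (B := B) ?_⟩
  have hd := h ((B.L 0 : ℝ) : UnitAddCircle)
  refine eq_univ_of_univ_subset ?_
  rw [← hd.closure_eq]
  refine closure_minimal ?_ isClosed_core
  rintro _ ⟨n, rfl⟩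
  exact homeo_zpow_mem_core ⟨0, Or.inl rfl⟩ n

end Blowup

/-! ### Step functions that code the rotation. -/

/-- A periodic `{0,1}`-valued step function on the line, given by its right-continuous version `r`
and its left-continuous version `l`, that jumps at finitely many points mod `1`, all of them in
`ℤα + ℤ`, and at `0`. -/
structure Coding (α : ℝ) where
  /-- The right-continuous version. -/
  r : ℝ → Fin 2
  /-- The left-continuous version. -/
  l : ℝ → Fin 2
  r_add_one : ∀ x, r (x + 1) = r x
  l_add_one : ∀ x, l (x + 1) = l x
  right : ∀ x, ∀ᶠ u in 𝓝[>] x, r u = r x ∧ l u = r x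
  left : ∀ x, ∀ᶠ u in 𝓝[<] x, r u = l x ∧ l u = l x
  mem_orbit : ∀ x, r x ≠ l x → x ∈ rotationOrbit α
  finite : {n : ℤ | r (n * α) ≠ l (n * α)}.Finite
  jump_zero : r 0 ≠ l 0

namespace Coding

variable {α : ℝ} (C : Coding α)

theorem r_add_int (x : ℝ) (k : ℤ) : C.r (x + k) = C.r x := by
  have : Periodic C.r 1 := C.r_add_one
  simpa using this.int_mul k x

theorem l_add_int (x : ℝ) (k : ℤ) : C.l (x + k) = C.l x := by
  have : Periodic C.l 1 := C.l_add_one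
  simpa using this.int_mul k x

/-- A step function with jumps only in `ℤα + ℤ` has no translational symmetry. -/
theorem exists_int_of_translate_eq {c : ℝ} (hr : ∀ t, C.r (t + c) = C.r t)
    (hl : ∀ t, C.l (t + c) = C.l t) : ∃ k : ℤ, c = k := by
  obtain ⟨j, k, rfl⟩ : c ∈ rotationOrbit α := C.mem_orbit c (by
    have h1 := hr 0
    have h2 := hl 0
    rw [zero_add] at h1 h2
    rw [h1, h2]; exact C.jump_zero)
  set J := {n : ℤ | C.r (n * α) ≠ C.l (n * α)}
  have h0 : (0 : ℤ) ∈ J := by simpa [J] using C.jump_zero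
  have hstep : ∀ n ∈ J, n + j ∈ J := fun n hn => by
    have e : ((n + j : ℤ) : ℝ) * α + k = n * α + (j * α + k) := by push_cast; ring
    have h1 := hr (n * α)
    have h2 := hl (n * α)
    rw [← e, C.r_add_int] at h1
    rw [← e, C.l_add_int] at h2
    change C.r _ ≠ C.l _
    rw [h1, h2]; exact hn
  -- The finite jump set is stable under adding `j`. Maximizing `j * n` rather than `n` treats both
  -- signs of `j` at once.
  obtain ⟨m, hm, hmax⟩ := C.finite.exists_maximalFor (fun n : ℤ => j * n) J ⟨0, h0⟩
  have hj : j = 0 := by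
    by_contra hj
    have : 0 < j * j := mul_self_pos.2 hj
    nlinarith [hmax (hstep m hm) (by nlinarith)]
  exact ⟨k, by simp [hj]⟩

end Coding

/-! ### Itineraries embed the minimal set in the shift. -/

namespace Blowup

variable {α : ℝ} (B : Blowup α) (C : Coding α)

/-- The coding function lifted to the blow-up; each blown-up interval is cut at its midpoint. -/
noncomputable def label (y : ℝ) : Fin 2 :=
  if B.L (B.collapse y) + B.R (B.collapse y) ≤ 2 * y then C.r (B.collapse y)
  else C.l (B.collapse y)

@[simp] theorem label_R (x : ℝ) : B.label C (B.R x) = C.r x := by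
  rw [label, collapse_R, if_pos (by linarith [B.le x])]

theorem r_eq_l_of_eq {x : ℝ} (h : ¬ B.L x < B.R x) : C.r x = C.l x := by
  by_contra hc
  exact h ((B.lt_iff x).2 (C.mem_orbit x hc))

@[simp] theorem label_L (x : ℝ) : B.label C (B.L x) = C.l x := by
  rw [label, collapse_L]
  split_ifs with h
  · exact B.r_eq_l_of_eq C (by linarith)
  · rfl

theorem label_add_one (y : ℝ) : B.label C (y + 1) = B.label C y := by
  rw [label, label, collapse_add_one, L_add_one, R_add_one, C.r_add_one, C.l_add_one]
  exact if_congr ⟨fun h => by linarith, fun h => by linarith⟩ rfl rfl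

theorem label_eq_of {y : ℝ} {a : Fin 2} (h : C.r (B.collapse y) = a ∧ C.l (B.collapse y) = a) :
    B.label C y = a := by
  rw [label]; split_ifs <;> simp [h]

theorem eventually_label_nhdsGT_R (x : ℝ) : ∀ᶠ y in 𝓝[>] (B.R x), B.label C y = C.r x := by
  have ht : Tendsto B.collapse (𝓝[>] (B.R x)) (𝓝[>] x) := by
    refine tendsto_nhdsWithin_iff.2 ⟨?_, ?_⟩
    · exact (B.continuous_collapse.tendsto' _ _ (B.collapse_R x)).mono_left nhdsWithin_le_nhds
    · filter_upwards [self_mem_nhdsWithin] with y hy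
      by_contra hc
      rw [mem_Ioi] at hc
      rcases (not_lt.1 hc).eq_or_lt with h | h
      · have := B.le_R_collapse y; rw [h] at this; exact absurd hy (not_lt.2 this)
      · have h1 := B.lt h
        have h2 : B.R x < y := hy
        linarith [B.le_R_collapse y, B.le x]
  filter_upwards [ht.eventually (C.right x)] with y hy using B.label_eq_of C hy

theorem eventually_label_nhdsLT_L (x : ℝ) : ∀ᶠ y in 𝓝[<] (B.L x), B.label C y = C.l x := by
  have ht : Tendsto B.collapse (𝓝[<] (B.L x)) (𝓝[<] x) := by
    refine tendsto_nhdsWithin_iff.2 ⟨?_, ?_⟩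
    · exact (B.continuous_collapse.tendsto' _ _ (B.collapse_L x)).mono_left nhdsWithin_le_nhds
    · filter_upwards [self_mem_nhdsWithin] with y hy
      by_contra hc
      rw [mem_Iio] at hc
      rcases (not_lt.1 hc).eq_or_lt with h | h
      · have := B.L_collapse_le y; rw [← h] at this; exact absurd hy (not_lt.2 this)
      · have h1 := B.lt h
        have h2 : y < B.L x := hy
        linarith [B.L_collapse_le y, B.le x]
  filter_upwards [ht.eventually (C.left x)] with y hy using B.label_eq_of C hy

theorem eventually_label_nhdsLT_R {x : ℝ} (hx : B.L x < B.R x) :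
    ∀ᶠ y in 𝓝[<] (B.R x), B.label C y = C.r x := by
  filter_upwards [Ioo_mem_nhdsLT (show (B.L x + B.R x) / 2 < B.R x by linarith)] with y hy
  rw [label, B.collapse_eq (x := x) (by linarith [hy.1]) hy.2.le, if_pos (by linarith [hy.1])]

theorem eventually_label_nhdsGT_L {x : ℝ} (hx : B.L x < B.R x) :
    ∀ᶠ y in 𝓝[>] (B.L x), B.label C y = C.l x := by
  filter_upwards [Ioo_mem_nhdsGT (show B.L x < (B.L x + B.R x) / 2 by linarith)] with y hy
  rw [label, B.collapse_eq (x := x) hy.1.le (by linarith [hy.2]), if_neg (by linarith [hy.2])]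

/-- The label is constant on each side of a core point. At the end of a genuine gap the two
constants agree, because the cut is at the midpoint; over a degenerate interval they agree because
the step function has no jump there. -/
theorem continuousAt_label {y : ℝ} (hy : (y : UnitAddCircle) ∈ B.core) :
    ContinuousAt (B.label C) y := by
  rw [coe_mem_core_iff] at hy
  set x := B.collapse y
  rw [continuousAt_iff_continuous_left'_right']
  have key : ∀ {s : Filter ℝ} {a b : Fin 2}, a = b → (∀ᶠ u in s, B.label C u = a) →
      Tendsto (B.label C) s (𝓝 b) := fun e h => by
    subst e; exact tendsto_nhds_of_eventually_eq h
  rcases hy with hy | hy <;> rw [hy]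
  · refine ⟨key (B.label_L C x).symm (B.eventually_label_nhdsLT_L C x), ?_⟩
    by_cases h : B.L x < B.R x
    · exact key (B.label_L C x).symm (B.eventually_label_nhdsGT_L C h)
    · have e := (B.le x).eq_of_not_lt h
      rw [e]
      exact key (B.label_R C x).symm (B.eventually_label_nhdsGT_R C x)
  · refine ⟨?_, key (B.label_R C x).symm (B.eventually_label_nhdsGT_R C x)⟩
    by_cases h : B.L x < B.R x
    · exact key (B.label_R C x).symm (B.eventually_label_nhdsLT_R C h)
    · have e := (B.le x).eq_of_not_lt h
      rw [← e]
      exact key (B.label_L C x).symm (B.eventually_label_nhdsLT_L C x)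

/-- `label` on the circle. -/
noncomputable def circleLabel : UnitAddCircle → Fin 2 :=
  Function.Periodic.lift (f := B.label C) (c := 1) (B.label_add_one C)

theorem circleLabel_coe (y : ℝ) : B.circleLabel C (y : UnitAddCircle) = B.label C y := rfl

theorem continuousAt_circleLabel {z : UnitAddCircle} (hz : z ∈ B.core) :
    ContinuousAt (B.circleLabel C) z := by
  induction z using QuotientAddGroup.induction_on with | H y => ?_
  have := B.continuousAt_label C hz
  change Tendsto _ (𝓝 (y : UnitAddCircle)) _
  rw [nhds_coe_unitAddCircle, tendsto_map'_iff]
  exact this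

/-- The itinerary of a point of the minimal set. -/
noncomputable def itinerary (z : B.core) : TwoShift := fun i => B.circleLabel C ((B.homeo ^ i) z)

theorem continuous_itinerary : Continuous (B.itinerary C) := by
  refine continuous_pi fun i => continuous_iff_continuousAt.2 fun z => ?_
  have h := B.continuousAt_circleLabel C (homeo_zpow_mem_core z.2 i)
  exact ContinuousAt.comp (f := fun z : B.core => (B.homeo ^ i) (z : UnitAddCircle)) h
    (by fun_prop)

theorem itinerary_apply {y : ℝ} (hy : (y : UnitAddCircle) ∈ B.core) (i : ℤ) :
    B.itinerary C ⟨y, hy⟩ i = B.label C (B.flow (i * α) y) := by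
  rw [itinerary, homeo_zpow_coe, circleLabel_coe]

theorem coe_L_mem_core (x : ℝ) : ((B.L x : ℝ) : UnitAddCircle) ∈ B.core := ⟨x, Or.inl rfl⟩

theorem coe_R_mem_core (x : ℝ) : ((B.R x : ℝ) : UnitAddCircle) ∈ B.core := ⟨x, Or.inr rfl⟩

theorem itinerary_L (x : ℝ) (i : ℤ) :
    B.itinerary C ⟨_, B.coe_L_mem_core x⟩ i = C.l (x + i * α) := by
  rw [itinerary_apply, flow_L, label_L]

theorem itinerary_R (x : ℝ) (i : ℤ) :
    B.itinerary C ⟨_, B.coe_R_mem_core x⟩ i = C.r (x + i * α) := by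
  rw [itinerary_apply, flow_R (intCast_mul_mem_rotationOrbit α i), label_R]

theorem exists_rep (z : B.core) : ∃ x : ℝ, z = ⟨_, B.coe_L_mem_core x⟩ ∨
    z = ⟨_, B.coe_R_mem_core x⟩ := by
  obtain ⟨z, x, h | h⟩ := z
  · exact ⟨x, Or.inl (Subtype.ext h)⟩
  · exact ⟨x, Or.inr (Subtype.ext h)⟩

/-- Suppose points over `x` and `x'` share an itinerary. Approaching any `t` along the dense orbit
of `x` from either side shows that translation by `x' - x` fixes both versions of the step function,
so `x' - x` is an integer. The two ends of a single gap are told apart by the jump at 0. -/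
theorem itinerary_injective (hα : Irrational α) : Injective (B.itinerary C) := by
  have trans : ∀ {x x' : ℝ} {z z' : B.core},
      (z = ⟨_, B.coe_L_mem_core x⟩ ∨ z = ⟨_, B.coe_R_mem_core x⟩) →
      (z' = ⟨_, B.coe_L_mem_core x'⟩ ∨ z' = ⟨_, B.coe_R_mem_core x'⟩) →
      B.itinerary C z = B.itinerary C z' → ∃ k : ℤ, x' = x + k := by
    intro x x' z z' hz hz' h
    -- Where the two versions agree, it does not matter which end of the interval `z` is.
    have rep : ∀ {x : ℝ} {z : B.core},
        (z = ⟨_, B.coe_L_mem_core x⟩ ∨ z = ⟨_, B.coe_R_mem_core x⟩) → ∀ {a : Fin 2} {n k : ℤ},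
        (C.r (x + n * α + k) = a ∧ C.l (x + n * α + k) = a) → B.itinerary C z n = a := by
      rintro x z (rfl | rfl) a n k ⟨h1, h2⟩
      · rw [itinerary_L, ← h2, C.l_add_int]
      · rw [itinerary_R, ← h1, C.r_add_int]
    have hshift : ∀ n k : ℤ, x + n * α + k + (x' - x) = x' + n * α + k := fun n k => by ring
    have hr : ∀ t, C.r (t + (x' - x)) = C.r t := fun t => by
      have e2 : Tendsto (fun u => u + (x' - x)) (𝓝[>] t) (𝓝[>] (t + (x' - x))) :=
        tendsto_nhdsGT_of_strictMono (strictMono_add_const _) (by fun_prop) t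
      obtain ⟨n, k, h1, h2⟩ := exists_of_eventually_nhdsGT hα x
        ((C.right t).and (e2.eventually (C.right (t + (x' - x)))))
      rw [hshift] at h2
      rw [← rep hz h1, h, rep hz' h2]
    have hl : ∀ t, C.l (t + (x' - x)) = C.l t := fun t => by
      have e2 : Tendsto (fun u => u + (x' - x)) (𝓝[<] t) (𝓝[<] (t + (x' - x))) :=
        tendsto_nhdsLT_of_strictMono (strictMono_add_const _) (by fun_prop) t
      obtain ⟨n, k, h1, h2⟩ := exists_of_eventually_nhdsLT hα x
        ((C.left t).and (e2.eventually (C.left (t + (x' - x)))))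
      rw [hshift] at h2
      rw [← rep hz h1, h, rep hz' h2]
    obtain ⟨k, hk⟩ := C.exists_int_of_translate_eq hr hl
    exact ⟨k, by linarith⟩
  have LR : ∀ x : ℝ, B.itinerary C ⟨_, B.coe_L_mem_core x⟩ = B.itinerary C ⟨_, B.coe_R_mem_core x⟩ →
      B.L x = B.R x := fun x h => by
    by_contra hne
    obtain ⟨n, k, rfl⟩ := (B.lt_iff x).1 (lt_of_le_of_ne (B.le x) hne)
    -- At time `-n` the orbit lies over an integer, where the versions differ.
    have := congrFun h (-n)
    rw [itinerary_L, itinerary_R,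
      show (n * α + k + (-n : ℤ) * α : ℝ) = 0 + k by push_cast; ring, C.r_add_int, C.l_add_int] at this
    exact C.jump_zero this.symm
  intro z z' h
  obtain ⟨x, hz⟩ := B.exists_rep z
  obtain ⟨x', hz'⟩ := B.exists_rep z'
  obtain ⟨k, rfl⟩ := trans hz hz' h
  simp only [L_add_int, R_add_int, coe_unitAddCircle_add_int] at hz'
  rcases hz with rfl | rfl <;> rcases hz' with rfl | rfl
  · rfl
  · exact Subtype.ext (congrArg (fun t : ℝ => (t : UnitAddCircle)) (LR x h))
  · exact Subtype.ext (congrArg (fun t : ℝ => (t : UnitAddCircle)) (LR x h.symm).symm)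
  · rfl

/-- The set of itineraries. -/
def itinerarySet : Set TwoShift := range (B.itinerary C)

theorem shift_itinerary (z : B.core) :
    shift (B.itinerary C z) = B.itinerary C (restrict B.homeo isInvariant_core z) := by
  funext i
  change B.circleLabel C ((B.homeo ^ (i + 1)) z) = B.circleLabel C ((B.homeo ^ i) (B.homeo z))
  rw [zpow_add_one]; rfl

theorem isInvariant_itinerarySet : IsInvariant shift (B.itinerarySet C) := by
  intro s
  constructor
  · rintro ⟨z, rfl⟩
    exact ⟨_, (B.shift_itinerary C z).symm⟩
  · rintro ⟨z, hz⟩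
    refine ⟨(restrict B.homeo isInvariant_core).symm z, shift.injective ?_⟩
    rw [shift_itinerary, Homeomorph.apply_symm_apply, hz]

instance : CompactSpace B.core := isCompact_iff_compactSpace.1 isClosed_core.isCompact

/-- The itinerary map as a homeomorphism onto its range. -/
noncomputable def itineraryHomeo (hα : Irrational α) : B.core ≃ₜ B.itinerarySet C :=
  Continuous.homeoOfEquivCompactToT2 (f := Equiv.ofInjective _ (B.itinerary_injective C hα))
    ((B.continuous_itinerary C).subtype_mk _)

theorem isDenjoyMinimalSet_itinerarySet (hα : Irrational α) :
    IsDenjoyMinimalSet shift (B.itinerarySet C) := by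
  refine ⟨B.isInvariant_itinerarySet C, B.homeo, isDenjoyExample_homeo hα, B.core,
    isMinimalSet_core hα, (B.itineraryHomeo C hα).symm, fun s => ?_⟩
  obtain ⟨z, rfl⟩ := (B.itineraryHomeo C hα).surjective s
  have : restrict shift (B.isInvariant_itinerarySet C) (B.itineraryHomeo C hα z) =
      B.itineraryHomeo C hα (restrict B.homeo isInvariant_core z) :=
    Subtype.ext (B.shift_itinerary C z)
  rw [this, Homeomorph.symm_apply_apply, Homeomorph.symm_apply_apply]
  rfl

end Blowup

/-! ### Unique ergodicity of irrational rotations. -/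

section RotationErgodic

open scoped BoundedContinuousFunction

instance : IsProbabilityMeasure (volume : Measure UnitAddCircle) :=
  ⟨UnitAddCircle.measure_univ⟩

theorem volume_singleton_unitAddCircle (z : UnitAddCircle) : volume {z} = 0 := by
  have h := AddCircle.volume_closedBall (T := 1) (x := z) 0
  simpa using h

theorem volume_eq_zero_of_countable {s : Set UnitAddCircle} (hs : s.Countable) : volume s = 0 := by
  rw [← biUnion_of_singleton s]
  exact (measure_biUnion_null_iff hs).2 fun z _ => volume_singleton_unitAddCircle z

theorem map_add_add {lam : Measure UnitAddCircle} (s t : UnitAddCircle) :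
    lam.map (· + (s + t)) = (lam.map (· + s)).map (· + t) := by
  rw [Measure.map_map (by fun_prop) (by fun_prop)]
  congr 1; funext x; simp [add_assoc]

/-- The translations that preserve a measure on the circle. -/
def stabilizingTranslations (lam : Measure UnitAddCircle) : AddSubgroup UnitAddCircle where
  carrier := {t | lam.map (· + t) = lam}
  zero_mem' := by
    change lam.map (· + 0) = lam
    simp
  add_mem' {s t} hs ht := by
    change lam.map (· + (s + t)) = lam
    rw [map_add_add, show lam.map (· + s) = lam from hs, show lam.map (· + t) = lam from ht]
  neg_mem' {t} ht := by
    change lam.map (· + -t) = lam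
    conv_lhs => rw [← show lam.map (· + t) = lam from ht]
    rw [← map_add_add]; simp

/-- Invariance is tested by integrals of bounded continuous functions, and these depend continuously
on the translation. -/
theorem isClosed_stabilizingTranslations (lam : Measure UnitAddCircle) [IsFiniteMeasure lam] :
    IsClosed (stabilizingTranslations lam : Set UnitAddCircle) := by
  have : (stabilizingTranslations lam : Set UnitAddCircle) =
      ⋂ f : UnitAddCircle →ᵇ ℝ, {t | ∫ x, f (x + t) ∂lam = ∫ x, f x ∂lam} := by
    ext t
    simp only [mem_iInter]
    change lam.map (· + t) = lam ↔ ∀ f : UnitAddCircle →ᵇ ℝ, ∫ x, f (x + t) ∂lam = ∫ x, f x ∂lam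
    have e : ∀ f : UnitAddCircle →ᵇ ℝ, ∫ x, f x ∂(lam.map (· + t)) = ∫ x, f (x + t) ∂lam := fun f =>
      integral_map (by fun_prop) f.continuous.aestronglyMeasurable
    constructor
    · intro h f
      rw [← e, h]
    · intro h
      have : IsFiniteMeasure (lam.map (· + t)) := inferInstance
      exact ext_of_forall_integral_eq_of_IsFiniteMeasure fun f => (e f).trans (h f)
  rw [this]
  refine isClosed_iInter fun f => isClosed_eq ?_ continuous_const
  refine continuous_of_dominated (bound := fun _ => ‖f‖) (fun t => ?_) (fun t => ?_) ?_ ?_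
  · exact (f.continuous.comp (continuous_id.add continuous_const)).aestronglyMeasurable
  · exact .of_forall fun x => f.norm_coe_le_norm _
  · exact integrable_const _
  · exact .of_forall fun x => f.continuous.comp (continuous_const.add continuous_id)

/-- An irrational rotation of the circle is uniquely ergodic. -/
theorem eq_volume_of_map_add_eq {α : ℝ} (hα : Irrational α) (lam : Measure UnitAddCircle)
    [IsProbabilityMeasure lam] (h : lam.map (· + (α : UnitAddCircle)) = lam) : lam = volume := by
  have hd : DenseRange (· • (α : UnitAddCircle) : ℤ → UnitAddCircle) :=
    AddCircle.denseRange_zsmul_coe_iff.2 (by simpa using hα)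
  have hall : ∀ t, t ∈ stabilizingTranslations lam := fun t => by
    have hsub : range (· • (α : UnitAddCircle) : ℤ → UnitAddCircle) ⊆
        stabilizingTranslations lam := by
      rintro _ ⟨n, rfl⟩
      exact zsmul_mem (show (α : UnitAddCircle) ∈ stabilizingTranslations lam from h) n
    exact closure_minimal hsub (isClosed_stabilizingTranslations lam) (hd t)
  have : lam.IsAddLeftInvariant := ⟨fun t => by
    simp_rw [add_comm t]; exact hall t⟩
  have hs := Measure.isAddInvariant_eq_smul_of_compactSpace lam volume
  have h1 := congrArg (fun m : Measure UnitAddCircle => m univ) hs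
  simp only [measure_univ, Measure.smul_apply] at h1
  have hc : lam.addHaarScalarFactor (volume : Measure UnitAddCircle) = 1 := by
    rw [ENNReal.smul_def, smul_eq_mul, mul_one] at h1
    exact_mod_cast h1.symm
  rw [hs, hc, one_smul]

end RotationErgodic

/-! ### The unique invariant measure on the set of itineraries. -/

namespace Blowup

variable {α : ℝ} (B : Blowup α) (C : Coding α)

/-- The right end of the interval replacing a point of the circle. -/
noncomputable def rightPoint (z : UnitAddCircle) : B.core :=
  ⟨_, B.coe_R_mem_core (AddCircle.measurableEquivIco 1 0 z : ℝ)⟩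

theorem rightPoint_coe (x : ℝ) : B.rightPoint x = ⟨_, B.coe_R_mem_core x⟩ := by
  refine Subtype.ext ?_
  have : ((AddCircle.measurableEquivIco 1 0 (x : UnitAddCircle) : ℝ) : UnitAddCircle) = x :=
    (AddCircle.equivIco 1 0).symm_apply_apply (x : UnitAddCircle)
  obtain ⟨k, hk⟩ := coe_unitAddCircle_eq_iff.1 this
  rw [rightPoint]
  conv_rhs => rw [hk]
  simp only [R_add_int, coe_unitAddCircle_add_int]

theorem R_mono : Monotone B.R := fun x y h => by
  rcases h.eq_or_lt with rfl | h
  · rfl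
  · exact (B.lt h).le.trans (B.le y)

theorem measurable_rightPoint : Measurable B.rightPoint := by
  refine Measurable.subtype_mk ?_
  exact AddCircle.measurable_mk'.comp (B.R_mono.measurable.comp
    (measurable_subtype_coe.comp (AddCircle.measurableEquivIco 1 0).measurable))

/-- The coding of an orbit of the rotation. -/
noncomputable def word (z : UnitAddCircle) : TwoShift := B.itinerary C (B.rightPoint z)

theorem word_coe (x : ℝ) (i : ℤ) : B.word C x i = C.r (x + i * α) := by
  rw [word, rightPoint_coe, itinerary_R]

theorem measurable_word : Measurable (B.word C) :=
  (B.continuous_itinerary C).measurable.comp B.measurable_rightPoint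

theorem word_mem (z : UnitAddCircle) : B.word C z ∈ B.itinerarySet C := mem_range_self _

theorem shift_word (z : UnitAddCircle) : shift (B.word C z) = B.word C (z + (α : UnitAddCircle)) := by
  induction z using QuotientAddGroup.induction_on with | H x => ?_
  funext i
  change B.word C (x : UnitAddCircle) (i + 1) = B.word C ((x : UnitAddCircle) + (α : UnitAddCircle)) i
  rw [← AddCircle.coe_add, word_coe, word_coe]
  congr 1; push_cast; ring

/-- The law of the coding of a uniformly distributed point. -/
noncomputable def wordMeasure : ProbabilityMeasure TwoShift :=
  ⟨(volume : Measure UnitAddCircle).map (B.word C),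
    Measure.isProbabilityMeasure_map (B.measurable_word C).aemeasurable⟩

theorem coe_wordMeasure : (B.wordMeasure C : Measure TwoShift) =
    (volume : Measure UnitAddCircle).map (B.word C) := rfl

theorem wordMeasure_mem_invariantMeasures : B.wordMeasure C ∈ invariantMeasures shift := by
  refine ⟨shift.continuous.measurable, ?_⟩
  rw [coe_wordMeasure, Measure.map_map shift.continuous.measurable (B.measurable_word C)]
  have : shift ∘ B.word C = B.word C ∘ (· + (α : UnitAddCircle)) := funext (B.shift_word C)
  rw [this, ← Measure.map_map (B.measurable_word C) (by fun_prop),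
    (measurePreserving_add_right volume (α : UnitAddCircle)).map_eq]

theorem isCompact_itinerarySet : IsCompact (B.itinerarySet C) :=
  isCompact_range (B.continuous_itinerary C)

theorem measurableSet_itinerarySet : MeasurableSet (B.itinerarySet C) :=
  (B.isCompact_itinerarySet C).isClosed.measurableSet

open Classical in
/-- The factor map from the set of itineraries onto the circle, extended by `0`. -/
noncomputable def position (hα : Irrational α) (s : TwoShift) : UnitAddCircle :=
  if h : s ∈ B.itinerarySet C then
    onCircle B.collapseLift ((B.itineraryHomeo C hα).symm ⟨s, h⟩ : UnitAddCircle) else 0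

theorem position_itinerary (hα : Irrational α) (z : B.core) :
    B.position C hα (B.itinerary C z) = onCircle B.collapseLift z := by
  have hz : B.itinerary C z ∈ B.itinerarySet C := mem_range_self _
  rw [position, dif_pos hz]
  congr 2
  exact (B.itineraryHomeo C hα).symm_apply_apply z

theorem measurable_position (hα : Irrational α) : Measurable (B.position C hα) := by
  classical
  refine Measurable.dite (s := B.itinerarySet C) (f := fun s => onCircle B.collapseLift
    ((B.itineraryHomeo C hα).symm s : UnitAddCircle)) (g := fun _ => 0) ?_ measurable_const
    (B.measurableSet_itinerarySet C)
  exact ((continuous_onCircle (F := B.collapseLift) B.continuous_collapse).comp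
    (continuous_subtype_val.comp (B.itineraryHomeo C hα).symm.continuous)).measurable

theorem position_shift (hα : Irrational α) {s : TwoShift} (hs : s ∈ B.itinerarySet C) :
    B.position C hα (shift s) = B.position C hα s + (α : UnitAddCircle) := by
  obtain ⟨⟨z, hz⟩, rfl⟩ := hs
  rw [shift_itinerary, position_itinerary, position_itinerary]
  induction z using QuotientAddGroup.induction_on with | H y => ?_
  change ((B.collapse (B.flow α y) : ℝ) : UnitAddCircle) =
    ((B.collapse y : ℝ) : UnitAddCircle) + (α : UnitAddCircle)
  rw [collapse_flow, AddCircle.coe_add]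

/-- Off the blown-up orbit the interval is a single point, so the position determines the itinerary.
-/
theorem word_position (hα : Irrational α) {s : TwoShift} (hs : s ∈ B.itinerarySet C)
    (h : B.position C hα s ∉ ((↑) : ℝ → UnitAddCircle) '' rotationOrbit α) :
    B.word C (B.position C hα s) = s := by
  obtain ⟨z, rfl⟩ := hs
  rw [position_itinerary] at h ⊢
  obtain ⟨x, rfl | rfl⟩ := B.exists_rep z
  · have e : onCircle B.collapseLift ((B.L x : ℝ) : UnitAddCircle) = (x : UnitAddCircle) :=
      congrArg _ (B.collapse_L x)
    rw [e] at h ⊢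
    have hx : x ∉ rotationOrbit α := fun hx => h (mem_image_of_mem _ hx)
    rw [← B.lt_iff] at hx
    rw [word, rightPoint_coe]
    exact congrArg _ (Subtype.ext (congrArg (fun t : ℝ => (t : UnitAddCircle))
      ((B.le x).eq_of_not_lt hx).symm))
  · have e : onCircle B.collapseLift ((B.R x : ℝ) : UnitAddCircle) = (x : UnitAddCircle) :=
      congrArg _ (B.collapse_R x)
    rw [e, word, rightPoint_coe]

/-- The position map turns the shift into the rotation, so it sends any invariant `ν` on the set to
Lebesgue measure. The countable blown-up orbit is null, and elsewhere `word` inverts the position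
map, so `ν` is recovered from Lebesgue measure. -/
theorem isUniqueInvariantMeasureOn_wordMeasure (hα : Irrational α) :
    IsUniqueInvariantMeasureOn shift (B.itinerarySet C) (B.wordMeasure C) := by
  refine ⟨⟨B.wordMeasure_mem_invariantMeasures C, ?_⟩, fun ν hν hY => ?_⟩
  · rw [coe_wordMeasure, Measure.map_apply (B.measurable_word C) (B.measurableSet_itinerarySet C),
      show B.word C ⁻¹' B.itinerarySet C = univ from eq_univ_of_forall (B.word_mem C), measure_univ]
  · have hae : ∀ᵐ s ∂(ν : Measure TwoShift), s ∈ B.itinerarySet C :=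
      (mem_ae_iff_prob_eq_one (B.measurableSet_itinerarySet C)).2 hY
    have hP := B.measurable_position C hα
    have : IsProbabilityMeasure ((ν : Measure TwoShift).map (B.position C hα)) :=
      Measure.isProbabilityMeasure_map hP.aemeasurable
    have hvol : (ν : Measure TwoShift).map (B.position C hα) = volume := by
      refine eq_volume_of_map_add_eq hα _ ?_
      rw [Measure.map_map (by fun_prop) hP]
      conv_rhs => rw [← hν.map_eq, Measure.map_map hP hν.measurable]
      refine Measure.map_congr ?_
      filter_upwards [hae] with s hs using (B.position_shift C hα hs).symm
    have hnull : ∀ᵐ s ∂(ν : Measure TwoShift),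
        B.position C hα s ∉ ((↑) : ℝ → UnitAddCircle) '' rotationOrbit α := by
      have hc : (((↑) : ℝ → UnitAddCircle) '' rotationOrbit α).Countable :=
        (countable_rotationOrbit α).image _
      have h0 := volume_eq_zero_of_countable hc
      rw [← hvol, Measure.map_apply hP hc.measurableSet] at h0
      exact measure_eq_zero_iff_ae_notMem.1 h0
    refine Subtype.ext ?_
    change (ν : Measure TwoShift) = (volume : Measure UnitAddCircle).map (B.word C)
    rw [← hvol, Measure.map_map (B.measurable_word C) hP]
    conv_lhs => rw [← Measure.map_id (μ := (ν : Measure TwoShift))]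
    refine Measure.map_congr ?_
    filter_upwards [hae, hnull] with s hs h using (B.word_position C hα hs h).symm

end Blowup

/-! ### Codings by arcs of length α near `1 / p`. -/

theorem eventually_floor_ceil_nhdsGT (x : ℝ) : ∀ᶠ u in 𝓝[>] x, ⌊u⌋ = ⌊x⌋ ∧ ⌈u⌉ = ⌊x⌋ + 1 := by
  filter_upwards [Ioo_mem_nhdsGT (Int.lt_floor_add_one x)] with u hu
  have h := Int.floor_le x
  refine ⟨Int.floor_eq_iff.2 ⟨by linarith [hu.1], hu.2⟩, Int.ceil_eq_iff.2 ⟨?_, ?_⟩⟩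
  · push_cast; linarith [hu.1]
  · push_cast; exact hu.2.le

theorem eventually_floor_ceil_nhdsLT (x : ℝ) : ∀ᶠ u in 𝓝[<] x, ⌊u⌋ = ⌈x⌉ - 1 ∧ ⌈u⌉ = ⌈x⌉ := by
  have h1 : (⌈x⌉ : ℝ) - 1 < x := by linarith [Int.ceil_lt_add_one x]
  filter_upwards [Ioo_mem_nhdsLT h1] with u hu
  have h := Int.le_ceil x
  refine ⟨Int.floor_eq_iff.2 ⟨?_, ?_⟩, Int.ceil_eq_iff.2 ⟨hu.1, by linarith [hu.2]⟩⟩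
  · push_cast; exact hu.1.le
  · push_cast; linarith [hu.2]

section BlockCode

variable (w : ℤ → Fin 2) (p : ℕ)

/-- The labels of the arcs: `w j` for the `j`-th of `p` arcs of length `α`, and something
different from `w 0` for the rest of the circle. -/
def arcLabel (j : ℤ) : Fin 2 := if j < p then w j else w 0 + 1

/-- The right-continuous step function taking the value `w j` on `[jα, (j + 1)α)`, `j < p`. -/
noncomputable def arcCodeRight (α x : ℝ) : Fin 2 := arcLabel w p ⌊(x - ⌊x⌋) / α⌋

/-- The left-continuous version of `arcCodeRight`. -/
noncomputable def arcCodeLeft (α x : ℝ) : Fin 2 := arcLabel w p (⌈(x - (⌈x⌉ - 1)) / α⌉ - 1)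

variable {α : ℝ}

theorem strictMono_sub_div (h0 : 0 < α) (c : ℝ) : StrictMono fun t : ℝ => (t - c) / α :=
  fun _ _ h => div_lt_div_of_pos_right (sub_lt_sub_right h c) h0

theorem exists_of_arcCode_ne {x : ℝ} (h0 : 0 < α)
    (h : arcCodeRight w p α x ≠ arcCodeLeft w p α x) :
    ∃ j k : ℤ, 0 ≤ j ∧ j ≤ p ∧ x = j * α + k := by
  by_cases hx : x = ⌊x⌋
  · exact ⟨0, ⌊x⌋, le_rfl, by positivity, by simpa using hx⟩
  have hc : ∀ {t : ℝ}, t ≠ ⌊t⌋ → ⌈t⌉ = ⌊t⌋ + 1 := fun {t} ht => by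
    refine Int.ceil_eq_iff.2 ⟨?_, ?_⟩
    · push_cast; linarith [lt_of_le_of_ne (Int.floor_le t) ht.symm]
    · push_cast; exact (Int.lt_floor_add_one t).le
  rw [arcCodeRight, arcCodeLeft, hc hx] at h
  push_cast at h
  rw [add_sub_cancel_right] at h
  set q := (x - ⌊x⌋) / α
  have hq0 : 0 ≤ q := div_nonneg (sub_nonneg.2 (Int.floor_le x)) h0.le
  have hq : q = ⌊q⌋ := by
    by_contra hq
    rw [hc hq, add_sub_cancel_right] at h
    exact h rfl
  refine ⟨⌊q⌋, ⌊x⌋, Int.floor_nonneg.2 hq0, ?_, ?_⟩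
  · by_contra! hlt
    have : ⌈q⌉ = ⌊q⌋ := by conv_lhs => rw [hq, Int.ceil_intCast]
    rw [this, arcLabel, arcLabel, if_neg (by omega), if_neg (by omega)] at h
    exact h rfl
  · rw [← hq, div_mul_cancel₀ _ h0.ne']; ring

theorem add_one_ne_self : ∀ a : Fin 2, a ≠ a + 1 := by decide

/-- The coding of the rotation by `α` for which the orbit of a point just to the right of `0`
starts with `w 0, …, w (p - 1)`. -/
noncomputable def arcCoding (hα : Irrational α) (h0 : 0 < α) (hp0 : 0 < p) (hp : p * α < 1) :
    Coding α where
  r := arcCodeRight w p α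
  l := arcCodeLeft w p α
  r_add_one x := by
    rw [arcCodeRight, arcCodeRight, Int.floor_add_one]; push_cast; congr 3; ring
  l_add_one x := by
    rw [arcCodeLeft, arcCodeLeft, Int.ceil_add_one]; push_cast; congr 4; ring
  right x := by
    have ht := tendsto_nhdsGT_of_strictMono (strictMono_sub_div h0 ⌊x⌋) (by fun_prop) x
    filter_upwards [eventually_floor_ceil_nhdsGT x, ht.eventually (eventually_floor_ceil_nhdsGT _)]
      with u hu hq
    rw [arcCodeRight, arcCodeLeft, arcCodeRight, hu.1, hu.2]
    push_cast
    rw [add_sub_cancel_right, hq.1, hq.2, add_sub_cancel_right]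
    exact ⟨rfl, rfl⟩
  left x := by
    have ht := tendsto_nhdsLT_of_strictMono (strictMono_sub_div h0 (⌈x⌉ - 1)) (by fun_prop) x
    filter_upwards [eventually_floor_ceil_nhdsLT x, ht.eventually (eventually_floor_ceil_nhdsLT _)]
      with u hu hq
    rw [arcCodeRight, arcCodeLeft, arcCodeLeft, hu.1, hu.2]
    push_cast
    rw [hq.1, hq.2]
    exact ⟨rfl, rfl⟩
  mem_orbit x h := by
    obtain ⟨j, k, -, -, h⟩ := exists_of_arcCode_ne w p h0 h
    exact ⟨j, k, h⟩
  finite := by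
    -- By irrationality the coefficient of α in a jump point is unique, hence one of `0, …, p`.
    refine (finite_Icc (0 : ℤ) p).subset fun n hn => ?_
    obtain ⟨j, k, hj0, hjp, h⟩ := exists_of_arcCode_ne w p h0 hn
    have : n - j = 0 := by
      by_contra hne
      refine (hα.intCast_mul hne).ne_int k ?_
      push_cast; linarith
    rw [mem_Icc]; omega
  jump_zero := by
    -- Since `p * α < 1`, the leftover arc lies just to the left of 0. Its label was chosen to
    -- differ from `w 0`, so 0 is a jump even for constant `w`.
    have h1 : ¬ (⌈(1 : ℝ) / α⌉ - 1 < (p : ℤ)) := by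
      have : (p : ℝ) < 1 / α := by rwa [lt_div_iff₀ h0]
      have : (p : ℤ) < ⌈(1 : ℝ) / α⌉ := Int.lt_ceil.2 (by exact_mod_cast this)
      omega
    have h2 : arcCodeLeft w p α 0 = w 0 + 1 := by
      rw [arcCodeLeft]; simp only [Int.ceil_zero, Int.cast_zero, zero_sub, sub_neg_eq_add,
        zero_add]
      rw [arcLabel, if_neg h1]
    rw [h2, arcCodeRight]
    simp only [Int.floor_zero, Int.cast_zero, sub_self, zero_div]
    rw [arcLabel]
    split_ifs with h
    · exact add_one_ne_self _
    · omega

/-- The `m`-th shift of the periodic sequence with period `w 0, …, w (p - 1)`. -/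
def periodicPoint (m : ℤ) : TwoShift := fun i => w ((m + i) % p)

/-- At `α = 1 / p` the arcs cut the circle into `p` equal parts, and the rotation permutes them
cyclically. The orbit of `x` avoids their ends, so the floors involved are locally constant in α. -/
theorem eventually_arcCodeRight_eq (hp : 0 < p) {x : ℝ} (hx : ∀ k : ℤ, p * x ≠ k) (i : ℤ) :
    ∀ᶠ α in 𝓝 (1 / p : ℝ), arcCodeRight w p α (x + i * α) = periodicPoint w p ⌊p * x⌋ i := by
  have hp' : (0 : ℝ) < p := by exact_mod_cast hp
  set v : ℝ := x + i * (1 / p) with hv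
  have hpv : p * v = p * x + i := by rw [hv]; field_simp
  have hvne : v ≠ ⌊v⌋ := fun h => hx (p * ⌊v⌋ - i) (by push_cast; rw [← h]; linarith)
  have hcont : ContinuousAt (fun α : ℝ => Int.fract (x + i * α) / α) (1 / p) :=
    ContinuousAt.div (ContinuousAt.comp (g := Int.fract) (f := fun α : ℝ => x + i * α)
      (continuousAt_fract hvne) (by fun_prop)) continuousAt_id (by positivity)
  set q : ℝ := Int.fract v / (1 / p) with hq
  have hqe : q = p * x + (i - p * ⌊v⌋ : ℤ) := by
    rw [hq, Int.fract]; push_cast; field_simp; linarith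
  have hqne : q ≠ ⌊q⌋ := fun h => hx (⌊q⌋ - (i - p * ⌊v⌋)) (by
    rw [Int.cast_sub, ← h]; linarith)
  have hfl : ⌊q⌋ = ⌊p * x⌋ + (i - p * ⌊v⌋) := by rw [hqe, Int.floor_add_intCast]
  have hq0 : 0 ≤ ⌊q⌋ := Int.floor_nonneg.2 (div_nonneg (Int.fract_nonneg _) (by positivity))
  have hqp : ⌊q⌋ < p := Int.floor_lt.2 (by
    rw [hq, div_lt_iff₀ (by positivity)]
    have := Int.fract_lt_one v
    simpa [hp'.ne'] using this)
  have hmem : Ioo (⌊q⌋ : ℝ) (⌊q⌋ + 1) ∈ 𝓝 q :=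
    Ioo_mem_nhds (lt_of_le_of_ne (Int.floor_le q) hqne.symm) (Int.lt_floor_add_one q)
  filter_upwards [hcont.eventually_mem hmem] with α hα
  have e : ⌊(x + i * α - ⌊x + i * α⌋) / α⌋ = ⌊q⌋ := Int.floor_eq_iff.2 ⟨hα.1.le, hα.2⟩
  rw [arcCodeRight, e, arcLabel, if_pos hqp, periodicPoint]
  congr 1
  rw [show ⌊p * x⌋ + i = ⌊q⌋ + p * ⌊v⌋ by rw [hfl]; ring, Int.add_mul_emod_self_left,
    Int.emod_eq_of_lt hq0 hqp]

end BlockCode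

theorem exists_irrational_seq {p : ℕ} (hp : 0 < p) : ∃ a : ℕ → ℝ,
    (∀ n, Irrational (a n) ∧ 0 < a n ∧ p * a n < 1) ∧ Tendsto a atTop (𝓝 (1 / p : ℝ)) := by
  have hp' : (0 : ℝ) < 1 / p := by positivity
  have h : ∀ n : ℕ, ∃ r, Irrational r ∧ 1 / p * (1 - 1 / ((n : ℝ) + 1)) < r ∧ r < 1 / p := fun n =>
    exists_irrational_btwn (mul_lt_of_lt_one_right hp' (by
      have : (0 : ℝ) < 1 / ((n : ℝ) + 1) := by positivity
      linarith))
  choose a ha hlo hhi using h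
  refine ⟨a, fun n => ⟨ha n, lt_of_le_of_lt (mul_nonneg hp'.le ?_) (hlo n), ?_⟩, ?_⟩
  · rw [sub_nonneg, div_le_one (by positivity)]
    have : (0 : ℝ) ≤ n := n.cast_nonneg
    linarith
  · have := hhi n
    rwa [lt_div_iff₀ (by exact_mod_cast hp), mul_comm] at this
  · refine tendsto_of_tendsto_of_tendsto_of_le_of_le ?_ tendsto_const_nhds (fun n => (hlo n).le)
      fun n => (hhi n).le
    have := (tendsto_one_div_add_atTop_nhds_zero_nat (𝕜 := ℝ)).const_sub 1
    simpa using this.const_mul (1 / p : ℝ)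

/-! ### Density of the points of Denjoy minimal sets. -/

/-- The points that belong to some Denjoy minimal set of the shift. -/
def denjoyPoints : Set TwoShift := {s | ∃ Y, IsDenjoyMinimalSet shift Y ∧ s ∈ Y}

/-- The unique invariant measures of Denjoy minimal sets of the shift. -/
def denjoyMeasures : Set (ProbabilityMeasure TwoShift) :=
  {μ | ∃ Y, IsDenjoyMinimalSet shift Y ∧ IsUniqueInvariantMeasureOn shift Y μ}

theorem exists_denjoy_seq (w : ℤ → Fin 2) {p : ℕ} (hp : 0 < p) :
    ∃ S : ℕ → UnitAddCircle → TwoShift, ∃ μ : ℕ → ProbabilityMeasure TwoShift,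
      (∀ n z, S n z ∈ denjoyPoints) ∧ (∀ n, μ n ∈ denjoyMeasures) ∧ (∀ n, Measurable (S n)) ∧
      (∀ n, (μ n : Measure TwoShift) = (volume : Measure UnitAddCircle).map (S n)) ∧
      ∀ x : ℝ, (∀ k : ℤ, p * x ≠ k) →
        Tendsto (fun n => S n x) atTop (𝓝 (periodicPoint w p ⌊p * x⌋)) := by
  obtain ⟨a, ha, hlim⟩ := exists_irrational_seq hp
  let B : ∀ n, Blowup (a n) := fun n => (exists_blowup (a n)).some
  let C : ∀ n, Coding (a n) := fun n => arcCoding w p (ha n).1 (ha n).2.1 hp (ha n).2.2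
  refine ⟨fun n => (B n).word (C n), fun n => (B n).wordMeasure (C n), fun n z => ?_, fun n => ?_,
    fun n => (B n).measurable_word (C n), fun n => rfl, fun x hx => ?_⟩
  · exact ⟨_, (B n).isDenjoyMinimalSet_itinerarySet (C n) (ha n).1, (B n).word_mem (C n) z⟩
  · exact ⟨_, (B n).isDenjoyMinimalSet_itinerarySet (C n) (ha n).1,
      (B n).isUniqueInvariantMeasureOn_wordMeasure (C n) (ha n).1⟩
  · refine tendsto_pi_nhds.2 fun i => tendsto_nhds_of_eventually_eq ?_
    filter_upwards [hlim.eventually (eventually_arcCodeRight_eq w p hp hx i)] with n hn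
    rw [← hn]
    exact (B n).word_coe (C n) x i

theorem periodicPoint_mem_closure (w : ℤ → Fin 2) {p : ℕ} (hp : 0 < p) (m : ℤ) :
    periodicPoint w p m ∈ closure denjoyPoints := by
  obtain ⟨S, -, hS, -, -, -, hlim⟩ := exists_denjoy_seq w hp
  have hp' : (p : ℝ) ≠ 0 := by exact_mod_cast hp.ne'
  -- The midpoint of the `m`-th arc avoids all arc ends.
  have hx : p * ((m + 1 / 2) / p : ℝ) = m + 1 / 2 := by field_simp
  have hfl : ⌊(m + 1 / 2 : ℝ)⌋ = m := by rw [Int.floor_intCast_add]; norm_num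
  have := hlim ((m + 1 / 2) / p) (fun k hk => by
    rw [hx] at hk
    have h1 : ((2 * (k - m) : ℤ) : ℝ) = 1 := by push_cast; linarith
    have h2 : 2 * (k - m) = 1 := by exact_mod_cast h1
    omega)
  rw [hx, hfl] at this
  exact mem_closure_of_tendsto this (.of_forall fun n => hS n _)

theorem dense_denjoyPoints : Dense denjoyPoints := by
  intro s
  -- The window `[-n, n]` of `s` is moved to `[0, 2n]`, repeated periodically, and recentred by the
  -- shift index `n`.
  refine closure_minimal (s := range fun n : ℕ => periodicPoint (fun j => s (j - n)) (2 * n + 1) n)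
    ?_ isClosed_closure (?_ : s ∈ _)
  · rintro _ ⟨n, rfl⟩
    exact periodicPoint_mem_closure _ (by omega) _
  · have ht : Tendsto (fun n : ℕ => periodicPoint (fun j => s (j - n)) (2 * n + 1) n) atTop
        (𝓝 s) := by
      refine tendsto_pi_nhds.2 fun i => tendsto_nhds_of_eventually_eq ?_
      filter_upwards [eventually_ge_atTop i.natAbs] with n hn
      rw [periodicPoint, Int.emod_eq_of_lt (by omega) (by push_cast; omega)]
      congr 1; ring
    exact mem_closure_of_tendsto ht (.of_forall fun n => mem_range_self n)

/-! ### Periodic orbit measures are limits of Denjoy measures. -/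

section PeriodicMeasure

variable (w : ℤ → Fin 2) (p : ℕ)

/-- The periodic orbit parametrized by the circle. -/
noncomputable def periodicMap (z : UnitAddCircle) : TwoShift :=
  periodicPoint w p ⌊p * (AddCircle.measurableEquivIco 1 0 z : ℝ)⌋

theorem measurable_periodicMap : Measurable (periodicMap w p) := by
  have h : Measurable fun z : UnitAddCircle => ⌊p * (AddCircle.measurableEquivIco 1 0 z : ℝ)⌋ :=
    Int.measurable_floor.comp ((measurable_subtype_coe.comp
      (AddCircle.measurableEquivIco 1 0).measurable).const_mul _)
  exact (measurable_from_top (f := periodicPoint w p)).comp h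

/-- The uniform measure on a periodic orbit of the shift. -/
noncomputable def periodicMeasure : ProbabilityMeasure TwoShift :=
  ⟨(volume : Measure UnitAddCircle).map (periodicMap w p),
    Measure.isProbabilityMeasure_map (measurable_periodicMap w p).aemeasurable⟩

theorem periodicMap_coe {x : ℝ} (hx : x ∈ Ico (0 : ℝ) 1) :
    periodicMap w p x = periodicPoint w p ⌊p * x⌋ := by
  have : ((AddCircle.measurableEquivIco 1 0 (x : UnitAddCircle) : ℝ)) = x :=
    congrArg Subtype.val ((AddCircle.equivIco 1 0).apply_symm_apply ⟨x, by simpa using hx⟩)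
  rw [periodicMap, this]

theorem intervalIntegral_floor (G : ℤ → ℝ) (p : ℕ) :
    ∫ x in (0 : ℝ)..p, G ⌊x⌋ = ∑ m ∈ Finset.range p, G m := by
  have hae : ∀ m : ℕ, ∀ᵐ x : ℝ, x ∈ uIoc (m : ℝ) ((m + 1 : ℕ) : ℝ) → G m = G ⌊x⌋ := fun m => by
    have : ∀ᵐ x : ℝ, x ≠ ((m + 1 : ℕ) : ℝ) := by
      simp [ae_iff]
    filter_upwards [this] with x hx hm
    rw [uIoc_of_le (by push_cast; linarith)] at hm
    have hlt := lt_of_le_of_ne hm.2 hx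
    push_cast at hlt
    rw [Int.floor_eq_iff.2 ⟨(by exact_mod_cast hm.1.le : (((m : ℕ) : ℤ) : ℝ) ≤ x), by
      exact_mod_cast hlt⟩]
  have h := intervalIntegral.sum_integral_adjacent_intervals (f := fun x : ℝ => G ⌊x⌋)
    (μ := volume) (a := fun k : ℕ => (k : ℝ)) (n := p) fun k _ =>
      (intervalIntegrable_const (c := G k)).congr_ae
        ((ae_restrict_iff' measurableSet_uIoc).2 (hae k))
  rw [Nat.cast_zero] at h
  rw [← h]
  refine Finset.sum_congr rfl fun m _ => ?_
  rw [← intervalIntegral.integral_congr_ae (hae m)]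
  simp

theorem integral_periodicMeasure {p : ℕ} (hp : 0 < p) (F : BoundedContinuousFunction TwoShift ℝ) :
    ∫ s, F s ∂(periodicMeasure w p : Measure TwoShift) =
      (∑ m ∈ Finset.range p, F (periodicPoint w p m)) / p := by
  have hp' : (p : ℝ) ≠ 0 := by exact_mod_cast hp.ne'
  change ∫ s, F s ∂((volume : Measure UnitAddCircle).map (periodicMap w p)) = _
  rw [integral_map (measurable_periodicMap w p).aemeasurable F.continuous.aestronglyMeasurable,
    ← UnitAddCircle.intervalIntegral_preimage 0]
  have : ∫ x in (0 : ℝ)..(0 + 1), F (periodicMap w p x) =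
      ∫ x in (0 : ℝ)..1, F (periodicPoint w p ⌊p * x⌋) := by
    rw [zero_add]
    refine intervalIntegral.integral_congr_ae ?_
    have h1 : ∀ᵐ x : ℝ, x ≠ 1 := by simp [ae_iff]
    filter_upwards [h1] with x hx hm
    rw [uIoc_of_le zero_le_one] at hm
    rw [periodicMap_coe w p ⟨hm.1.le, lt_of_le_of_ne hm.2 hx⟩]
  rw [this, intervalIntegral.integral_comp_mul_left (fun y => F (periodicPoint w p ⌊y⌋)) hp',
    mul_zero, mul_one, intervalIntegral_floor fun m => F (periodicPoint w p m)]
  rw [smul_eq_mul, div_eq_inv_mul]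

/-- Both measures are images of Lebesgue measure on the circle. The coding maps converge pointwise
off the null set of arc ends, so dominated convergence applies. -/
theorem periodicMeasure_mem_closure {p : ℕ} (hp : 0 < p) :
    periodicMeasure w p ∈ closure denjoyMeasures := by
  obtain ⟨S, μ, -, hμ, hmeas, hmap, hlim⟩ := exists_denjoy_seq w hp
  have hp' : (p : ℝ) ≠ 0 := by exact_mod_cast hp.ne'
  have ht : Tendsto μ atTop (𝓝 (periodicMeasure w p)) := by
    rw [ProbabilityMeasure.tendsto_iff_forall_integral_tendsto]
    intro F
    change Tendsto _ _ (𝓝 (∫ s, F s ∂((volume : Measure UnitAddCircle).map (periodicMap w p))))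
    simp_rw [hmap]
    rw [integral_map (measurable_periodicMap w p).aemeasurable F.continuous.aestronglyMeasurable]
    have e : ∀ n, ∫ s, F s ∂((volume : Measure UnitAddCircle).map (S n)) = ∫ z, F (S n z) :=
      fun n => integral_map (hmeas n).aemeasurable F.continuous.aestronglyMeasurable
    simp_rw [e]
    refine tendsto_integral_of_dominated_convergence (fun _ => ‖F‖) (fun n => ?_)
      (integrable_const _) (fun n => .of_forall fun z => F.norm_coe_le_norm _) ?_
    · exact (F.continuous.measurable.comp (hmeas n)).aestronglyMeasurable
    · have hc : (range fun k : ℤ => ((k / p : ℝ) : UnitAddCircle)).Countable := countable_range _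
      filter_upwards [measure_eq_zero_iff_ae_notMem.1 (volume_eq_zero_of_countable hc)] with z hz
      have hrep : (((AddCircle.measurableEquivIco 1 0 z : ℝ)) : UnitAddCircle) = z :=
        (AddCircle.equivIco 1 0).symm_apply_apply z
      have hx := hlim (AddCircle.measurableEquivIco 1 0 z : ℝ) fun k hk => hz ⟨k, by
        rw [← hrep]; simp only [← hk]; rw [mul_div_cancel_left₀ _ hp']⟩
      rw [hrep] at hx
      exact (F.continuous.tendsto _).comp hx
  exact mem_closure_of_tendsto ht (.of_forall hμ)

end PeriodicMeasure

/-! ### Finite windows, empirical distributions and boundary errors. -/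

/-- A continuous function on the sequence space almost depends on finitely many coordinates. -/
theorem exists_window {F : TwoShift → ℝ} (hF : Continuous F) {ε : ℝ} (hε : 0 < ε) :
    ∃ n : ℕ, ∀ s t : TwoShift, (∀ i : ℤ, i.natAbs ≤ n → s i = t i) → |F s - F t| ≤ ε := by
  by_contra! hc
  -- These are decreasing nonempty compact sets of bad pairs; a common element would be a pair of
  -- equal sequences on which `F` differs by at least `ε`.
  set A : ℕ → Set (TwoShift × TwoShift) := fun n =>
    (⋂ i : ℤ, {q | i.natAbs ≤ n → q.1 i = q.2 i}) ∩ {q | ε ≤ |F q.1 - F q.2|}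
  have hclosed : ∀ n, IsClosed (A n) := fun n => by
    refine (isClosed_iInter fun i => ?_).inter (isClosed_le continuous_const (by fun_prop))
    by_cases h : i.natAbs ≤ n
    · simp only [h, true_imp_iff]
      exact isClosed_eq (by fun_prop) (by fun_prop)
    · simp [h]
  obtain ⟨q, hq⟩ := IsCompact.nonempty_iInter_of_sequence_nonempty_isCompact_isClosed A
    (fun n q hq => ⟨mem_iInter.2 fun i hi => mem_iInter.1 hq.1 i (hi.trans n.le_succ), hq.2⟩)
    (fun n => by
      obtain ⟨s, t, h1, h2⟩ := hc n
      exact ⟨(s, t), mem_iInter.2 h1, h2.le⟩)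
    (hclosed 0).isCompact hclosed
  rw [mem_iInter] at hq
  have e : q.1 = q.2 := funext fun i => mem_iInter.1 (hq i.natAbs).1 i le_rfl
  have h : ε ≤ |F q.1 - F q.2| := (hq 0).2
  rw [e, sub_self, abs_zero] at h
  linarith

/-- Finite probability vectors are approximated by empirical distributions. -/
theorem exists_empirical {V : Type*} [Fintype V] (q : V → ℝ) (hq : ∀ v, 0 ≤ q v)
    (hq1 : ∑ v, q v = 1) {δ : ℝ} (hδ : 0 < δ) :
    ∃ M : ℕ, 0 < M ∧ ∃ v : ℕ → V, ∀ (Φ : V → ℝ) (b : ℝ), (∀ u, |Φ u| ≤ b) →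
      |(∑ k ∈ Finset.range M, Φ (v k)) / M - ∑ u, q u * Φ u| ≤ δ * b := by
  classical
  have hne : Nonempty V := by
    by_contra h
    rw [not_nonempty_iff] at h
    simp at hq1
  obtain ⟨N, hN⟩ := exists_nat_gt (2 * Fintype.card V / δ)
  -- Rounding up puts the total `M` between `N` and `N + card V`, so the errors sum to at most `2 *
  -- card V / M`, which the choice of `N` makes less than `δ`.
  set n : V → ℕ := fun u => ⌊q u * N⌋₊ + 1
  set M := ∑ u, n u
  have hn : ∀ u, q u * N < n u ∧ (n u : ℝ) ≤ q u * N + 1 := fun u => by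
    have h0 : 0 ≤ q u * N := mul_nonneg (hq u) N.cast_nonneg
    refine ⟨?_, ?_⟩
    · simpa [n] using Nat.lt_floor_add_one (q u * N)
    · simpa [n] using Nat.floor_le h0
  have hM : (M : ℝ) = ∑ u, (n u : ℝ) := by simp [M]
  have hNM : (N : ℝ) < M := by
    have : ∑ u, q u * (N : ℝ) < ∑ u, (n u : ℝ) :=
      Finset.sum_lt_sum_of_nonempty Finset.univ_nonempty fun u _ => (hn u).1
    rwa [← Finset.sum_mul, hq1, one_mul, ← hM] at this
  have hMN : (M : ℝ) ≤ N + Fintype.card V := by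
    have : ∑ u, (n u : ℝ) ≤ ∑ u, (q u * (N : ℝ) + 1) := Finset.sum_le_sum fun u _ => (hn u).2
    rwa [Finset.sum_add_distrib, ← Finset.sum_mul, hq1, one_mul, ← hM, Finset.sum_const,
      Finset.card_univ, nsmul_eq_mul, mul_one] at this
  have hM0 : (0 : ℝ) < M := lt_of_le_of_lt N.cast_nonneg hNM
  have hcard : Fintype.card (Σ u, Fin (n u)) = M := by simp [M]
  let e := Fintype.equivFinOfCardEq hcard
  refine ⟨M, by exact_mod_cast hM0,
    fun k => if h : k < M then (e.symm ⟨k, h⟩).1 else Classical.arbitrary V, fun Φ b hb => ?_⟩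
  have hsum : ∑ k ∈ Finset.range M,
      Φ (if h : k < M then (e.symm ⟨k, h⟩).1 else Classical.arbitrary V) = ∑ u, n u * Φ u := by
    rw [Finset.sum_range]
    simp only [Fin.is_lt, dif_pos, Fin.eta]
    rw [Equiv.sum_comp e.symm (fun x : Σ u, Fin (n u) => Φ x.1), Fintype.sum_sigma]
    simp
  rw [hsum, Finset.sum_div, ← Finset.sum_sub_distrib]
  have hterm : ∀ u, |n u * Φ u / M - q u * Φ u| ≤ (1 + q u * Fintype.card V) / M * b := fun u => by
    have h1 : |(n u - q u * M : ℝ)| ≤ 1 + q u * Fintype.card V := by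
      have h2 := (hn u).1
      have h3 := (hn u).2
      have h4 := mul_le_mul_of_nonneg_left hNM.le (hq u)
      have h5 := mul_le_mul_of_nonneg_left hMN (hq u)
      rw [abs_le]
      constructor <;> nlinarith
    rw [show n u * Φ u / M - q u * Φ u = (n u - q u * M) / M * Φ u by field_simp, abs_mul, abs_div,
      abs_of_pos hM0]
    exact mul_le_mul (by gcongr) (hb u) (abs_nonneg _)
      (div_nonneg ((abs_nonneg _).trans h1) hM0.le)
  have hb0 : 0 ≤ b := (abs_nonneg _).trans (hb (Classical.arbitrary V))
  calc |∑ u, (n u * Φ u / M - q u * Φ u)| ≤ ∑ u, (1 + q u * Fintype.card V) / M * b :=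
        (Finset.abs_sum_le_sum_abs _ _).trans (Finset.sum_le_sum fun u _ => hterm u)
    _ = 2 * Fintype.card V / M * b := by
        rw [← Finset.sum_mul, ← Finset.sum_div, Finset.sum_add_distrib, ← Finset.sum_mul, hq1, Finset.sum_const, Finset.card_univ,
          nsmul_eq_mul]
        ring
    _ ≤ δ * b := by
        gcongr
        rw [div_le_iff₀ hM0]
        rw [div_lt_iff₀ hδ] at hN
        nlinarith

/-- If two bounded sequences are close away from the ends of `[0, L)`, their sums are close. -/
theorem abs_sum_sub_le {a c : ℕ → ℝ} {ε b : ℝ} {n L : ℕ} (hε : 0 ≤ ε) (ha : ∀ o, |a o| ≤ b)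
    (hc : ∀ o, |c o| ≤ b) (h : ∀ o, n ≤ o → o + n < L → |a o - c o| ≤ ε) :
    |∑ o ∈ Finset.range L, a o - ∑ o ∈ Finset.range L, c o| ≤ L * ε + 4 * n * b := by
  have hb : 0 ≤ b := (abs_nonneg _).trans (ha 0)
  -- At most `2n` indices lie near the ends, and each costs at most `2b`.
  have hterm : ∀ o ∈ Finset.range L, |a o - c o| ≤
      ε + if o ∈ Finset.range n ∪ Finset.Ico (L - n) L then 2 * b else 0 := fun o ho => by
    split_ifs with hm
    · have := abs_sub (a o) (c o)
      linarith [ha o, hc o]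
    · rw [Finset.mem_union, Finset.mem_range, Finset.mem_Ico] at hm
      rw [Finset.mem_range] at ho
      rw [add_zero]
      exact h o (by omega) (by omega)
  have hcard : ((Finset.range n ∪ Finset.Ico (L - n) L).card : ℝ) ≤ 2 * n := by
    have h1 := Finset.card_union_le (Finset.range n) (Finset.Ico (L - n) L)
    rw [Finset.card_range, Nat.card_Ico] at h1
    have : (Finset.range n ∪ Finset.Ico (L - n) L).card ≤ 2 * n := by omega
    exact_mod_cast this
  rw [← Finset.sum_sub_distrib]
  refine (Finset.abs_sum_le_sum_abs _ _).trans ((Finset.sum_le_sum hterm).trans ?_)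
  rw [Finset.sum_add_distrib, Finset.sum_const, Finset.card_range, nsmul_eq_mul,
    ← Finset.sum_filter, Finset.sum_const, nsmul_eq_mul]
  have hle : (((Finset.range L).filter
      (· ∈ Finset.range n ∪ Finset.Ico (L - n) L)).card : ℝ) ≤ 2 * n :=
    le_trans (by exact_mod_cast Finset.card_le_card fun o ho => (Finset.mem_filter.1 ho).2) hcard
  nlinarith

/-! ### Invariant measures are limits of periodic orbit measures. -/

section Approximation

/-- Translation of a sequence by `m`. -/
def translateSeq (m : ℕ) (s : TwoShift) : TwoShift := fun i => s (i + m)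

/-- A block extended by zeros. -/
def extendBlock {L : ℕ} (v : Fin L → Fin 2) : TwoShift :=
  fun i => if h : 0 ≤ i ∧ i.toNat < L then v ⟨i.toNat, h.2⟩ else 0

/-- The initial block of a sequence. -/
def initialBlock (L : ℕ) (s : TwoShift) : Fin L → Fin 2 := fun j => s (j : ℕ)

theorem measurable_initialBlock (L : ℕ) : Measurable (initialBlock L) :=
  measurable_pi_lambda _ fun _ => measurable_pi_apply _

theorem extendBlock_apply {L : ℕ} (v : Fin L → Fin 2) {i : ℤ} {m : ℕ} (hm : m < L) (hi : i = m) :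
    extendBlock v i = v ⟨m, hm⟩ := by
  subst hi
  rw [extendBlock, dif_pos ⟨by omega, by simpa using hm⟩]
  congr

theorem extendBlock_initialBlock {L : ℕ} (s : TwoShift) {i : ℤ} (h0 : 0 ≤ i) (hi : i < L) :
    extendBlock (initialBlock L s) i = s i := by
  rw [extendBlock_apply (m := i.toNat) _ (by omega) (by omega), initialBlock]
  congr 1; simp [h0]

theorem measurePreserving_translateSeq {μ : ProbabilityMeasure TwoShift}
    (hμ : μ ∈ invariantMeasures shift) (m : ℕ) :
    MeasurePreserving (translateSeq m) (μ : Measure TwoShift) (μ : Measure TwoShift) := by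
  have h : MeasurePreserving shift (μ : Measure TwoShift) (μ : Measure TwoShift) := hμ
  have e : translateSeq m = shift^[m] := by
    induction m with
    | zero => funext s i; simp [translateSeq]
    | succ m ih =>
      rw [iterate_succ', ← ih]
      funext s i
      change s (i + (m + 1 : ℕ)) = s (i + 1 + m)
      congr 1; push_cast; ring
  rw [e]
  exact h.iterate m

/-- The average of `F` over the translates of a block. -/
noncomputable def blockAverage (F : TwoShift → ℝ) {L : ℕ} (v : Fin L → Fin 2) : ℝ :=
  (∑ o ∈ Finset.range L, F (translateSeq o (extendBlock v))) / L

variable {F : BoundedContinuousFunction TwoShift ℝ} {ε : ℝ} {n L : ℕ}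

theorem abs_blockAverage_le (v : Fin L → Fin 2) : |blockAverage F v| ≤ ‖F‖ := by
  rw [blockAverage, abs_div, Nat.abs_cast]
  refine div_le_of_le_mul₀ L.cast_nonneg (norm_nonneg _) ?_
  refine (Finset.abs_sum_le_sum_abs _ _).trans
    ((Finset.sum_le_sum fun o _ => F.norm_coe_le_norm _).trans ?_)
  simp [mul_comm]

/-- By invariance `F` may be averaged over `L` translates. A translate whose window of radius `n`
stays inside `[0, L)` depends, up to `ε`, on the initial block alone. -/
theorem abs_integral_sub_blockAverage_le {μ : ProbabilityMeasure TwoShift}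
    (hμ : μ ∈ invariantMeasures shift) (hL : 0 < L) (hε : 0 ≤ ε)
    (hn : ∀ s t : TwoShift, (∀ i : ℤ, i.natAbs ≤ n → s i = t i) → |F s - F t| ≤ ε) :
    |∫ s, F s ∂(μ : Measure TwoShift) -
      ∫ s, blockAverage F (initialBlock L s) ∂(μ : Measure TwoShift)| ≤ ε + 4 * n * ‖F‖ / L := by
  have hL' : (0 : ℝ) < L := by exact_mod_cast hL
  have hint : ∀ o, Integrable (fun s => F (translateSeq o s)) (μ : Measure TwoShift) := fun o =>
    (measurePreserving_translateSeq hμ o).integrable_comp_of_integrable (F.integrable _)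
  have h1 : ∫ s, F s ∂(μ : Measure TwoShift) =
      ∫ s, (∑ o ∈ Finset.range L, F (translateSeq o s)) / L ∂(μ : Measure TwoShift) := by
    rw [integral_div, integral_finsetSum _ fun o _ => hint o]
    have : ∀ o ∈ Finset.range L, ∫ s, F (translateSeq o s) ∂(μ : Measure TwoShift) =
        ∫ s, F s ∂(μ : Measure TwoShift) := fun o _ => by
      have hT := measurePreserving_translateSeq hμ o
      conv_rhs => rw [← hT.map_eq]
      exact (integral_map hT.measurable.aemeasurable F.continuous.aestronglyMeasurable).symm
    rw [Finset.sum_congr rfl this, Finset.sum_const, Finset.card_range, nsmul_eq_mul,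
      mul_div_cancel_left₀ _ hL'.ne']
  have hmeas : Measurable fun s => blockAverage F (initialBlock L s) :=
    (measurable_of_finite (blockAverage F (L := L))).comp (measurable_initialBlock L)
  have hint2 : Integrable (fun s => blockAverage F (initialBlock L s)) (μ : Measure TwoShift) :=
    (integrable_const ‖F‖).mono' hmeas.aestronglyMeasurable
      (.of_forall fun s => abs_blockAverage_le _)
  rw [h1, ← integral_sub ((integrable_finsetSum _ fun o _ => hint o).div_const _) hint2]
  have hb : ∀ s, ‖(∑ o ∈ Finset.range L, F (translateSeq o s)) / L -
      blockAverage F (initialBlock L s)‖ ≤ ε + 4 * n * ‖F‖ / L := fun s => by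
    rw [blockAverage, ← sub_div, Real.norm_eq_abs, abs_div, abs_of_pos hL', div_le_iff₀ hL']
    refine (abs_sum_sub_le (n := n) hε (fun o => F.norm_coe_le_norm _)
      (fun o => F.norm_coe_le_norm _) fun o h1 h2 => hn _ _ fun i hi => ?_).trans (le_of_eq ?_)
    · rw [translateSeq, translateSeq, extendBlock_initialBlock _ (by omega) (by omega)]
    · field_simp
  have := norm_integral_le_of_norm_le_const (μ := (μ : Measure TwoShift)) (.of_forall hb)
  simpa using this

/-- The concatenation of a sequence of blocks of length `L`. -/
def concatBlocks (v : ℕ → Fin L → Fin 2) (hL : 0 < L) (j : ℤ) : Fin 2 :=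
  v (j.toNat / L) ⟨j.toNat % L, Nat.mod_lt _ hL⟩

theorem sum_range_mul (f : ℕ → ℝ) (L M : ℕ) : ∑ m ∈ Finset.range (L * M), f m =
    ∑ k ∈ Finset.range M, ∑ o ∈ Finset.range L, f (L * k + o) := by
  induction M with
  | zero => simp
  | succ M ih => rw [Nat.mul_succ, Finset.sum_range_add, ih, Finset.sum_range_succ]

/-- The average over the periodic orbit splits into `M` block sums, and in each only the positions
within `n` of a block end see a neighbouring block. -/
theorem abs_periodicAverage_sub_le {M : ℕ} (v : ℕ → Fin L → Fin 2) (hL : 0 < L) (hM : 0 < M)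
    (hε : 0 ≤ ε)
    (hn : ∀ s t : TwoShift, (∀ i : ℤ, i.natAbs ≤ n → s i = t i) → |F s - F t| ≤ ε) :
    |∫ s, F s ∂(periodicMeasure (concatBlocks v hL) (L * M) : Measure TwoShift) -
      (∑ k ∈ Finset.range M, blockAverage F (v k)) / M| ≤ ε + 4 * n * ‖F‖ / L := by
  have hL' : (0 : ℝ) < L := by exact_mod_cast hL
  have hM' : (0 : ℝ) < M := by exact_mod_cast hM
  rw [integral_periodicMeasure _ (Nat.mul_pos hL hM), sum_range_mul]
  simp only [blockAverage]
  rw [← Finset.sum_div, div_div, Nat.cast_mul, ← sub_div, ← Finset.sum_sub_distrib, abs_div,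
    abs_of_pos (mul_pos hL' hM'), div_le_iff₀ (mul_pos hL' hM')]
  have hterm : ∀ k ∈ Finset.range M,
      |∑ o ∈ Finset.range L, F (periodicPoint (concatBlocks v hL) (L * M) (L * k + o : ℕ)) -
        ∑ o ∈ Finset.range L, F (translateSeq o (extendBlock (v k)))| ≤ L * ε + 4 * n * ‖F‖ := by
    intro k hk
    rw [Finset.mem_range] at hk
    refine abs_sum_sub_le (n := n) hε (fun o => F.norm_coe_le_norm _)
      (fun o => F.norm_coe_le_norm _) fun o h1 h2 => hn _ _ fun i hi => ?_
    obtain ⟨m, hm⟩ : ∃ m : ℕ, i + o = m := ⟨(i + o).toNat, by omega⟩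
    have hmL : m < L := by omega
    have hlt : L * k + m < L * M := by
      have := Nat.mul_le_mul_left L (Nat.succ_le_of_lt hk)
      rw [Nat.mul_succ] at this
      omega
    have e : (((L * k + o : ℕ) : ℤ) + i) % ((L * M : ℕ) : ℤ) = ((L * k + m : ℕ) : ℤ) := by
      rw [show ((L * k + o : ℕ) : ℤ) + i = ((L * k + m : ℕ) : ℤ) by
        rw [Nat.cast_add, Nat.cast_add]; linarith]
      exact Int.emod_eq_of_lt (by omega) (by exact_mod_cast hlt)
    rw [translateSeq, extendBlock_apply _ hmL hm, periodicPoint, e, concatBlocks]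
    have e1 : ((L * k + m : ℕ) : ℤ).toNat / L = k := by
      rw [Int.toNat_natCast, Nat.mul_add_div hL, Nat.div_eq_of_lt hmL, add_zero]
    have e2 : ((L * k + m : ℕ) : ℤ).toNat % L = m := by
      rw [Int.toNat_natCast, Nat.mul_add_mod, Nat.mod_eq_of_lt hmL]
    simp only [e1, e2]
  refine (Finset.abs_sum_le_sum_abs _ _).trans ((Finset.sum_le_sum hterm).trans (le_of_eq ?_))
  rw [Finset.sum_const, Finset.card_range, nsmul_eq_mul]
  field_simp

/-- The blocks realize the law of the initial `L`-block up to `1 / L`. The periodic word is chosen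
before `F`, `ε` and `n`, so one sequence of measures serves every test function. -/
theorem exists_periodicMeasure_approx {μ : ProbabilityMeasure TwoShift}
    (hμ : μ ∈ invariantMeasures shift) (hL : 0 < L) : ∃ (w : ℤ → Fin 2) (p : ℕ), 0 < p ∧
      ∀ (F : BoundedContinuousFunction TwoShift ℝ) (ε : ℝ) (n : ℕ), 0 ≤ ε →
        (∀ s t : TwoShift, (∀ i : ℤ, i.natAbs ≤ n → s i = t i) → |F s - F t| ≤ ε) →
        |∫ s, F s ∂(periodicMeasure w p : Measure TwoShift) - ∫ s, F s ∂(μ : Measure TwoShift)| ≤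
          2 * ε + (8 * n + 1) * ‖F‖ / L := by
  have hL' : (0 : ℝ) < L := by exact_mod_cast hL
  set ν := (μ : Measure TwoShift).map (initialBlock L)
  have : IsProbabilityMeasure ν :=
    Measure.isProbabilityMeasure_map (measurable_initialBlock L).aemeasurable
  obtain ⟨M, hM, v, hv⟩ := exists_empirical (fun u : Fin L → Fin 2 => ν.real {u})
    (fun u => measureReal_nonneg) (by simp) (one_div_pos.2 hL')
  refine ⟨concatBlocks v hL, L * M, Nat.mul_pos hL hM, fun F ε n hε hn => ?_⟩
  have h1 := abs_periodicAverage_sub_le v hL hM hε hn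
  have h2 := abs_integral_sub_blockAverage_le hμ hL hε hn
  have h3 := hv (fun u => blockAverage F u) ‖F‖ abs_blockAverage_le
  have h4 : ∫ s, blockAverage F (initialBlock L s) ∂(μ : Measure TwoShift) =
      ∑ u, ν.real {u} * blockAverage F u := by
    rw [← integral_map (measurable_initialBlock L).aemeasurable
      (f := fun u => blockAverage F u) (measurable_of_finite _).aestronglyMeasurable,
      integral_fintype (.of_finite)]
    simp [ν]
  rw [← h4] at h3
  have h5 : (8 * n + 1) * ‖F‖ / L = 4 * n * ‖F‖ / L + 4 * n * ‖F‖ / L + 1 / L * ‖F‖ := by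
    field_simp; ring
  rw [h5]
  rw [abs_le] at h1 h2 h3 ⊢
  constructor <;> linarith [h1.1, h1.2, h2.1, h2.2, h3.1, h3.2]

theorem invariantMeasures_subset_closure_denjoyMeasures :
    invariantMeasures shift ⊆ closure denjoyMeasures := by
  intro μ hμ
  choose w p hp happ using fun l : ℕ => exists_periodicMeasure_approx hμ l.succ_pos
  have ht : Tendsto (fun l => periodicMeasure (w l) (p l)) atTop (𝓝 μ) := by
    rw [ProbabilityMeasure.tendsto_iff_forall_integral_tendsto]
    intro F
    rw [Metric.tendsto_atTop']
    intro ε hε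
    -- The window is fixed first; the bound is then `ε / 2` plus a term that vanishes as the block
    -- length grows.
    obtain ⟨n, hn⟩ := exists_window F.continuous (show 0 < ε / 4 by positivity)
    have hlim : Tendsto (fun l : ℕ => (8 * n + 1) * ‖F‖ / ((l + 1 : ℕ) : ℝ)) atTop (𝓝 0) :=
      (tendsto_const_div_atTop_nhds_zero_nat _).comp (tendsto_add_atTop_nat 1)
    obtain ⟨l₀, hl₀⟩ := eventually_atTop.1 (hlim.eventually_lt_const (show 0 < ε / 2 by positivity))
    refine ⟨l₀, fun l hl => ?_⟩
    rw [Real.dist_eq]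
    refine (happ l F (ε / 4) n (by positivity) hn).trans_lt ?_
    have := hl₀ l hl.le
    rw [Nat.succ_eq_add_one]
    linarith
  refine closure_minimal (s := range fun l => periodicMeasure (w l) (p l)) ?_ isClosed_closure
    (mem_closure_of_tendsto ht (.of_forall fun l => mem_range_self l))
  rintro _ ⟨l, rfl⟩
  exact periodicMeasure_mem_closure (w l) (hp l)

end Approximation

end DenjoySets

theorem proposition0p3 :
    Dense {s : DenjoySets.TwoShift |
      ∃ Y : Set DenjoySets.TwoShift, DenjoySets.IsDenjoyMinimalSet DenjoySets.shift Y ∧ s ∈ Y} ∧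
    Dense {μ : DenjoySets.invariantMeasures DenjoySets.shift |
      ∃ Y : Set DenjoySets.TwoShift, DenjoySets.IsDenjoyMinimalSet DenjoySets.shift Y ∧
        DenjoySets.IsUniqueInvariantMeasureOn DenjoySets.shift Y
          (μ : ProbabilityMeasure DenjoySets.TwoShift)} := by
  refine ⟨DenjoySets.dense_denjoyPoints, Subtype.dense_iff.2 ?_⟩
  refine DenjoySets.invariantMeasures_subset_closure_denjoyMeasures.trans (closure_mono ?_)
  rintro μ ⟨Y, hY, hμ⟩
  exact ⟨⟨μ, hμ.1.1⟩, ⟨Y, hY, hμ⟩, rfl⟩
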